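/- Identify the group of Möbius transformations of $\hat{\mathbb C}=\mathbb C\cup\{\infty\}$ with $PSL(2,\mathbb C)$. A circle in $\hat{\mathbb C}$ is a Euclidean circle or a Euclidean line together with $\infty$; its complement in $\hat{\mathbb C}$ has two components, and for each circle considered one of them is chosen as its interior, the other being its exterior. A subgroup $G$ of $PSL(2,\mathbb C)$ is called marked classical T-Schottky on the generators $g_1,\dots,g_n$ if $G=\langle g_1,\dots,g_n\rangle$ and there are $2n$ circles $C_1,C_1',\dots,C_n,C_n'$ in $\hat{\mathbb C}$, with chosen interiors, such that the $2n$ interiors are pairwise disjoint (tangencies of the circles are allowed) and each $g_i$ maps the exterior of $C_i$ onto the interior of $C_i'$. The group $G$ is called classical T-Schottky if it is marked classical T-Schottky on some finite system of generators $g_1,\dots,g_n$ (with $n$ arbitrary). Theorem 6.7. Let $S,T\in PSL(2,\mathbb C)$ be parabolic with distinct fixed points in $\hat{\mathbb C}$ (equivalently, $G=\langle S,T\rangle$ is non-elementary). Then $G=\langle S,T\rangle$ is marked classical T-Schottky on the generators $S,T$ if and only if $G$ is classical T-Schottky. -/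

import Mathlib

/-!
Suppose `G = ⟨S, T⟩` is classical T-Schottky on `g 0, …, g (n - 1)`. By ping-pong `G` is free on the
`g i`, so `n = 2` and `S`, `T` come from a generating pair `s`, `t` of the free group `F₂`.

If `y`, `x` are cyclically consecutive letters of the cyclically reduced form of a word representing
a parabolic element, then ping-pong traps the fixed point of a conjugate between the circles of
`y⁻¹` and `x`, which are therefore tangent there. Two circles are tangent at only one point when a
third disc is disjoint from both, and no conjugates of `s` and `t` commute; hence the cyclic words
of `s` and `t` have disjoint Whitehead graphs. In rank two, with exponent sums forming a unimodular
matrix, this forces one of the two to be conjugate to a generator `a`.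

The other is then `a ^ m * b * a ^ n` up to that conjugation, with `b` the other generator or its
inverse, and a further conjugation makes the pair `a`, `b * a ^ N`. Uniqueness of tangency points
again excludes `|N| ≥ 2`. For `N = ±1`, in the normal form `z + k`, `z / (z + 1)` of the pair `a`,
`b * a ^ N`, the condition `4 ≤ |k| + |Im k|` is necessary for the circles of `a` and `b` to exist,
and sufficient for circles of `a` and `b * a ^ N`.
-/

/-- The group `PSL(2, ℂ)` of Möbius transformations. -/
abbrev Moebius : Type := Matrix.ProjectiveSpecialLinearGroup (Fin 2) ℂ

/-- The action of Möbius transformations on the Riemann sphere `ℂ ∪ {∞}`, transported from the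
action of `PSL(2, ℂ)` on the complex projective line. -/
noncomputable instance Moebius.instMulAction : MulAction Moebius (OnePoint ℂ) :=
  (OnePoint.equivProjectivization ℂ).mulAction Moebius

/-- The class of `A ∈ SL(2, ℂ)` acts by the usual formula `z ↦ (a z + b) / (c z + d)`. -/
theorem Moebius.mk_smul (A : Matrix.SpecialLinearGroup (Fin 2) ℂ) (z : OnePoint ℂ) :
    (QuotientGroup.mk A : Moebius) • z = (A : Matrix.GeneralLinearGroup (Fin 2) ℂ) • z :=
  rfl

/-- A Möbius transformation is parabolic if it is represented by a parabolic matrix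
(non-scalar, with a double eigenvalue; that is, not the identity and of squared trace `4`). -/
def Moebius.IsParabolic (g : Moebius) : Prop :=
  ∃ A : Matrix.SpecialLinearGroup (Fin 2) ℂ,
    (QuotientGroup.mk A : Moebius) = g ∧ (A : Matrix (Fin 2) (Fin 2) ℂ).IsParabolic

/-- A circle in the Riemann sphere, with a choice of which of its two sides is the interior.
The circle is the zero set of `a |z|² + 2 Re (conj b * z) + c`, where `a c < |b|²`:
for `a ≠ 0` it is the Euclidean circle with centre `-b / a` and radius
`√(|b|² - a c) / |a| > 0`, and for `a = 0` (hence `b ≠ 0`) it is a line together with `∞`. -/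
structure OrientedCircle where
  a : ℝ
  b : ℂ
  c : ℝ
  nondegenerate : a * c < Complex.normSq b

namespace OrientedCircle

/-- The defining function of the circle; only its sign at `∞` is meaningful, and it is
the sign of `a`. -/
noncomputable def form (C : OrientedCircle) (z : OnePoint ℂ) : ℝ :=
  z.elim C.a fun w => C.a * Complex.normSq w + 2 * (starRingEnd ℂ C.b * w).re + C.c

/-- The interior: the open side on which the defining function is negative. -/
def interior (C : OrientedCircle) : Set (OnePoint ℂ) := {z | C.form z < 0}

/-- The exterior: the other open side. -/
def exterior (C : OrientedCircle) : Set (OnePoint ℂ) := {z | 0 < C.form z}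

end OrientedCircle

/-- Circles `C i`, `C' i` and Möbius transformations `g i` form a classical T-Schottky
configuration: the interiors of the `2n` circles are pairwise disjoint (the circles themselves
may be tangent), and each `g i` maps the exterior of `C i` onto the interior of `C' i`. -/
structure IsClassicalTSchottkyConfiguration {n : ℕ} (C C' : Fin n → OrientedCircle)
    (g : Fin n → Moebius) : Prop where
  disjoint_interiors : Pairwise fun p q : Fin n ⊕ Fin n =>
    Disjoint (Sum.elim C C' p).interior (Sum.elim C C' q).interior
  side_pairing : ∀ i, (fun z => g i • z) '' (C i).exterior = (C' i).interior

/-- `G` is a marked classical T-Schottky group on the generators `g 0, …, g (n - 1)`. -/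
def IsMarkedClassicalTSchottky (G : Subgroup Moebius) {n : ℕ} (g : Fin n → Moebius) : Prop :=
  G = Subgroup.closure (Set.range g) ∧
    ∃ C C' : Fin n → OrientedCircle, IsClassicalTSchottkyConfiguration C C' g

/-- `G` is a classical T-Schottky group: it is marked classical T-Schottky on some finite
system of generators. -/
def IsClassicalTSchottky (G : Subgroup Moebius) : Prop :=
  ∃ (n : ℕ) (g : Fin n → Moebius), IsMarkedClassicalTSchottky G g

open scoped InnerProductSpace

namespace OrientedCircle

open Matrix Complex ComplexConjugate

/-- The Hermitian form on `ℂ²` of which `form` is the restriction to `(w, 1)` and `(1, 0)`. -/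
noncomputable def herm (C : OrientedCircle) (u v : ℂ) : ℝ :=
  C.a * normSq u + 2 * (conj C.b * u * conj v).re + C.c * normSq v

@[simp]
theorem form_infty (C : OrientedCircle) : C.form OnePoint.infty = C.a := rfl

theorem form_coe (C : OrientedCircle) (w : ℂ) :
    C.form w = C.a * (w.re * w.re + w.im * w.im) + 2 * (C.b.re * w.re + C.b.im * w.im) + C.c := by
  simp [form, normSq_apply]

@[simp]
theorem form_zero (C : OrientedCircle) : C.form (0 : ℂ) = C.c := by
  simp [form_coe]

theorem mem_interior {C : OrientedCircle} {z : OnePoint ℂ} : z ∈ C.interior ↔ C.form z < 0 :=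
  Iff.rfl

theorem mem_exterior {C : OrientedCircle} {z : OnePoint ℂ} : z ∈ C.exterior ↔ 0 < C.form z :=
  Iff.rfl

theorem herm_coe_one (C : OrientedCircle) (w : ℂ) : C.herm w 1 = C.form w := by
  simp [form, herm]

theorem herm_one_zero (C : OrientedCircle) : C.herm 1 0 = C.form OnePoint.infty := by
  simp [herm]

theorem herm_mul (C : OrientedCircle) (t u v : ℂ) :
    C.herm (t * u) (t * v) = normSq t * C.herm u v := by
  simp only [herm, normSq_apply, mul_re, mul_im, conj_re, conj_im]
  ring

theorem exists_pos_herm_eq_mul_form (C : OrientedCircle) {u v : ℂ} (huv : v = 0 → u ≠ 0) :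
    ∃ r : ℝ, 0 < r ∧
      C.herm u v = r * C.form (if v = 0 then OnePoint.infty else ((u / v : ℂ) : OnePoint ℂ)) := by
  split_ifs with hv
  · refine ⟨normSq u, normSq_pos.2 (huv hv), ?_⟩
    rw [← herm_one_zero, ← herm_mul, mul_one, mul_zero, hv]
  · refine ⟨normSq v, normSq_pos.2 hv, ?_⟩
    rw [← herm_coe_one, ← herm_mul, mul_div_cancel₀ _ hv, mul_one]

/-- The circle with the opposite side as its interior. -/
def flip (C : OrientedCircle) : OrientedCircle where
  a := -C.a
  b := -C.b
  c := -C.c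
  nondegenerate := by simpa using C.nondegenerate

theorem form_flip (C : OrientedCircle) (z : OnePoint ℂ) : C.flip.form z = -C.form z := by
  induction z using OnePoint.rec with
  | infty => rfl
  | coe w => simp only [form_coe, flip, neg_re, neg_im]; ring

theorem interior_flip (C : OrientedCircle) : C.flip.interior = C.exterior := by
  ext z
  simp [mem_interior, mem_exterior, form_flip]

theorem exterior_flip (C : OrientedCircle) : C.flip.exterior = C.interior := by
  ext z
  simp [mem_interior, mem_exterior, form_flip]

/-- The preimage of a circle under the Möbius transformation of a matrix; its Hermitian form is
the pullback of the Hermitian form of the circle. -/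
noncomputable def comapSL (C : OrientedCircle) (A : SpecialLinearGroup (Fin 2) ℂ) :
    OrientedCircle where
  a := C.herm (A 0 0) (A 1 0)
  b := C.a * conj (A 0 0) * A 0 1 + conj C.b * A 0 1 * conj (A 1 0) +
    C.b * conj (A 0 0) * A 1 1 + C.c * conj (A 1 0) * A 1 1
  c := C.herm (A 0 1) (A 1 1)
  nondegenerate := by
    have discriminant_mul (p q r s : ℂ) :
        normSq (C.a * conj p * q + conj C.b * q * conj r + C.b * conj p * s + C.c * conj r * s) -
          C.herm p r * C.herm q s = (normSq C.b - C.a * C.c) * normSq (p * s - q * r) := by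
      simp only [herm, normSq_apply, mul_re, mul_im, conj_re, conj_im, add_re, add_im, sub_re,
        sub_im, ofReal_re, ofReal_im]
      ring
    have hdet : A 0 0 * A 1 1 - A 0 1 * A 1 0 = 1 := by rw [← det_fin_two, A.det_coe]
    have key := discriminant_mul (A 0 0) (A 0 1) (A 1 0) (A 1 1)
    rw [hdet, map_one, mul_one] at key
    linarith [C.nondegenerate]

theorem herm_comapSL (C : OrientedCircle) (A : SpecialLinearGroup (Fin 2) ℂ) (u v : ℂ) :
    (C.comapSL A).herm u v = C.herm (A 0 0 * u + A 0 1 * v) (A 1 0 * u + A 1 1 * v) := by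
  simp only [comapSL, herm, normSq_apply, mul_re, mul_im, conj_re, conj_im, add_re, add_im,
    ofReal_re, ofReal_im]
  ring

theorem form_comapSL (C : OrientedCircle) (A : SpecialLinearGroup (Fin 2) ℂ) (z : OnePoint ℂ) :
    ∃ r : ℝ, 0 < r ∧ (C.comapSL A).form z = r * C.form ((QuotientGroup.mk A : Moebius) • z) := by
  have hdet : A 0 0 * A 1 1 - A 0 1 * A 1 0 = 1 := by rw [← det_fin_two, A.det_coe]
  rw [Moebius.mk_smul]
  induction z using OnePoint.rec with
  | infty =>
    rw [← herm_one_zero, herm_comapSL, OnePoint.smul_infty_eq_ite]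
    simp only [mul_one, mul_zero, add_zero]
    exact C.exists_pos_herm_eq_mul_form fun h h' => by simp [h, h'] at hdet
  | coe w =>
    rw [← herm_coe_one, herm_comapSL, OnePoint.smul_some_eq_ite]
    simp only [mul_one]
    refine C.exists_pos_herm_eq_mul_form fun h h' => one_ne_zero (α := ℂ) ?_
    linear_combination A 0 0 * h - A 1 0 * h' - hdet

/-- The preimage of a circle under a Möbius transformation. -/
noncomputable def comap (C : OrientedCircle) (h : Moebius) : OrientedCircle :=
  C.comapSL (Quotient.out h)

theorem form_comap (C : OrientedCircle) (h : Moebius) (z : OnePoint ℂ) :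
    ∃ r : ℝ, 0 < r ∧ (C.comap h).form z = r * C.form (h • z) := by
  have := C.form_comapSL (Quotient.out h) z
  rwa [QuotientGroup.out_eq'] at this

theorem mem_interior_comap {C : OrientedCircle} {h : Moebius} {z : OnePoint ℂ} :
    z ∈ (C.comap h).interior ↔ h • z ∈ C.interior := by
  obtain ⟨r, hr, e⟩ := C.form_comap h z
  rw [mem_interior, mem_interior, e]
  exact smul_neg_iff_of_pos_left hr

theorem mem_exterior_comap {C : OrientedCircle} {h : Moebius} {z : OnePoint ℂ} :
    z ∈ (C.comap h).exterior ↔ h • z ∈ C.exterior := by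
  obtain ⟨r, hr, e⟩ := C.form_comap h z
  rw [mem_exterior, mem_exterior, e, mul_pos_iff_of_pos_left hr]

theorem form_comap_eq_zero {C : OrientedCircle} {h : Moebius} {z : OnePoint ℂ} :
    (C.comap h).form z = 0 ↔ C.form (h • z) = 0 := by
  obtain ⟨r, hr, e⟩ := C.form_comap h z
  rw [e, mul_eq_zero, or_iff_right hr.ne']

theorem interior_comap (C : OrientedCircle) (h : Moebius) :
    (C.comap h).interior = (h • ·) ⁻¹' C.interior :=
  Set.ext fun _ => mem_interior_comap

theorem disjoint_comap {C D : OrientedCircle} (h : Moebius)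
    (H : Disjoint C.interior D.interior) :
    Disjoint (C.comap h).interior (D.comap h).interior := by
  rw [interior_comap, interior_comap]
  exact H.preimage _

end OrientedCircle

namespace Moebius

open Matrix

/-- The matrix with the given entries, as an element of `SL(2, ℂ)`. -/
def matrixOf (a b c d : ℂ) (h : a * d - b * c = 1) : SpecialLinearGroup (Fin 2) ℂ :=
  ⟨!![a, b; c, d], by rw [Matrix.det_fin_two_of, h]⟩

/-- The Möbius transformation `z ↦ (a z + b) / (c z + d)`. -/
def ofEntries (a b c d : ℂ) (h : a * d - b * c = 1) : Moebius :=
  QuotientGroup.mk (matrixOf a b c d h)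

theorem ofEntries_smul_infty (a b c d : ℂ) (h : a * d - b * c = 1) :
    ofEntries a b c d h • (OnePoint.infty : OnePoint ℂ) =
      if c = 0 then OnePoint.infty else ((a / c : ℂ) : OnePoint ℂ) := by
  rw [ofEntries, mk_smul, OnePoint.smul_infty_eq_ite]
  rfl

theorem ofEntries_smul_coe (a b c d : ℂ) (h : a * d - b * c = 1) (w : ℂ) :
    ofEntries a b c d h • (w : OnePoint ℂ) =
      if c * w + d = 0 then OnePoint.infty
      else (((a * w + b) / (c * w + d) : ℂ) : OnePoint ℂ) := by
  rw [ofEntries, mk_smul, OnePoint.smul_some_eq_ite]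
  rfl

theorem matrixOf_mul {a b c d a' b' c' d' : ℂ} (h : a * d - b * c = 1)
    (h' : a' * d' - b' * c' = 1) :
    matrixOf a b c d h * matrixOf a' b' c' d' h' =
      matrixOf (a * a' + b * c') (a * b' + b * d') (c * a' + d * c') (c * b' + d * d')
        (by linear_combination h * (a' * d' - b' * c') + h') := by
  apply Subtype.ext
  change !![a, b; c, d] * !![a', b'; c', d'] = !![_, _; _, _]
  rw [Matrix.mul_fin_two]

theorem ofEntries_mul {a b c d a' b' c' d' : ℂ} (h : a * d - b * c = 1)
    (h' : a' * d' - b' * c' = 1) :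
    ofEntries a b c d h * ofEntries a' b' c' d' h' =
      ofEntries (a * a' + b * c') (a * b' + b * d') (c * a' + d * c') (c * b' + d * d')
        (by linear_combination h * (a' * d' - b' * c') + h') := by
  rw [ofEntries, ofEntries, ofEntries, ← matrixOf_mul h h']
  rfl

theorem ofEntries_neg {a b c d : ℂ} (h : a * d - b * c = 1) :
    ofEntries (-a) (-b) (-c) (-d) (by linear_combination h) = ofEntries a b c d h := by
  have hJ : ofEntries (-1) 0 0 (-1) (by norm_num) = 1 := by
    rw [ofEntries, QuotientGroup.eq_one_iff, Matrix.SpecialLinearGroup.mem_center_iff]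
    refine ⟨-1, by simp, ?_⟩
    change _ = !![(-1 : ℂ), 0; 0, -1]
    ext i j
    fin_cases i <;> fin_cases j <;> simp
  rw [← one_mul (ofEntries a b c d h), ← hJ, ofEntries_mul]
  simp

@[simp] theorem ofEntries_one : ofEntries 1 0 0 1 (by simp) = 1 := by
  rw [ofEntries, QuotientGroup.eq_one_iff]
  convert Subgroup.one_mem _
  apply Subtype.ext
  exact Matrix.one_fin_two.symm

theorem eq_ofEntries (A : SpecialLinearGroup (Fin 2) ℂ) :
    (QuotientGroup.mk A : Moebius) = ofEntries (A 0 0) (A 0 1) (A 1 0) (A 1 1)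
      (by rw [← Matrix.det_fin_two]; exact A.det_coe) := by
  rw [ofEntries]
  congr 1
  apply Subtype.ext
  exact Matrix.eta_fin_two A.1

/-- The translation `z ↦ z + k`. -/
def transl (k : ℂ) : Moebius := ofEntries 1 k 0 1 (by simp)

/-- The parabolic transformation `z ↦ z / (z + 1)` fixing `0`. -/
def unitParabolic : Moebius := ofEntries 1 0 1 1 (by simp)

@[simp] theorem transl_smul_infty (k : ℂ) :
    transl k • (OnePoint.infty : OnePoint ℂ) = OnePoint.infty := by
  simp [transl, ofEntries_smul_infty]

@[simp] theorem transl_smul_coe (k w : ℂ) :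
    transl k • (w : OnePoint ℂ) = ((w + k : ℂ) : OnePoint ℂ) := by
  simp [transl, ofEntries_smul_coe]

theorem transl_mul (k l : ℂ) : transl k * transl l = transl (k + l) := by
  simp [transl, ofEntries_mul, add_comm]

theorem unitParabolic_smul_coe (w : ℂ) (hw : w + 1 ≠ 0) :
    unitParabolic • (w : OnePoint ℂ) = ((w / (w + 1) : ℂ) : OnePoint ℂ) := by
  simp [unitParabolic, ofEntries_smul_coe, hw]

theorem exists_smul_infty_eq (z : OnePoint ℂ) :
    ∃ h : Moebius, h • (OnePoint.infty : OnePoint ℂ) = z := by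
  induction z using OnePoint.rec with
  | infty => exact ⟨1, one_smul _ _⟩
  | coe w => exact ⟨ofEntries w (-1) 1 0 (by simp), by simp [ofEntries_smul_infty]⟩

theorem exists_smul_infty_eq_smul_zero_eq {p q : OnePoint ℂ} (hpq : p ≠ q) :
    ∃ h : Moebius, h • (OnePoint.infty : OnePoint ℂ) = p ∧ h • ((0 : ℂ) : OnePoint ℂ) = q := by
  obtain ⟨h, rfl⟩ := exists_smul_infty_eq p
  have : h⁻¹ • q ≠ OnePoint.infty := fun e => hpq (by rw [← e, smul_inv_smul])
  obtain ⟨w, hw⟩ := OnePoint.ne_infty_iff_exists.1 this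
  refine ⟨h * transl w, by simp [mul_smul], ?_⟩
  rw [mul_smul, transl_smul_coe, zero_add, hw, smul_inv_smul]

theorem isParabolic_transl {k : ℂ} (hk : k ≠ 0) : (transl k).IsParabolic := by
  refine ⟨_, rfl, (Matrix.isParabolic_iff_of_upperTriangular rfl).2 ⟨rfl, hk⟩⟩

theorem transl_inv (k : ℂ) : (transl k)⁻¹ = transl (-k) := by
  rw [inv_eq_iff_mul_eq_one, transl_mul, add_neg_cancel]
  exact ofEntries_one

/-- The transformation `z ↦ -1 / z`. -/
def inversion : Moebius := ofEntries 0 (-1) 1 0 (by simp)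

theorem inversion_smul_infty :
    inversion • (OnePoint.infty : OnePoint ℂ) = ((0 : ℂ) : OnePoint ℂ) := by
  simp [inversion, ofEntries_smul_infty]

theorem inversion_inv : inversion⁻¹ = inversion := by
  rw [inv_eq_iff_mul_eq_one, inversion, ofEntries_mul, ← ofEntries_neg]
  simp

/-- Diagonal matrices rescale the two fixed points `∞` and `0` independently of each other. -/
theorem exists_conj_transl_unitParabolic (k : ℂ) {l : ℂ} (hl : l ≠ 0) :
    ∃ (D : Moebius) (k' : ℂ), transl k = D * transl k' * D⁻¹ ∧
      inversion * transl l * inversion⁻¹ = D * unitParabolic * D⁻¹ := by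
  obtain ⟨c, hc⟩ := IsAlgClosed.exists_pow_nat_eq (-l⁻¹) (n := 2) (by simp)
  have hc0 : c ≠ 0 := by rintro rfl; simp [hl] at hc
  have hlc : l * c = -c⁻¹ := by
    rw [eq_neg_iff_add_eq_zero]
    field_simp
    rw [hc]
    field_simp
    ring
  refine ⟨ofEntries c 0 0 c⁻¹ (by field_simp; ring), k * (c⁻¹) ^ 2, ?_, ?_⟩
  · rw [eq_mul_inv_iff_mul_eq]
    simp only [transl, ofEntries_mul]
    congr 1 <;> field_simp <;> ring
  · rw [eq_mul_inv_iff_mul_eq, inversion_inv]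
    simp only [inversion, transl, unitParabolic, ofEntries_mul]
    rw [← ofEntries_neg]
    simp [hlc]

theorem isParabolic_unitParabolic : unitParabolic.IsParabolic := by
  refine ⟨_, rfl, ?_, ?_⟩
  · rintro ⟨r, hr⟩
    simpa [matrixOf] using congrFun (congrFun hr 1) 0
  · norm_num [matrixOf, discr_fin_two, trace_fin_two, det_fin_two]

theorem unitParabolic_smul_zero :
    unitParabolic • ((0 : ℂ) : OnePoint ℂ) = ((0 : ℂ) : OnePoint ℂ) := by
  simp [unitParabolic_smul_coe]

namespace IsParabolic

theorem conj {g : Moebius} (hg : g.IsParabolic) (h : Moebius) : (h * g * h⁻¹).IsParabolic := by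
  obtain ⟨A, rfl, hA⟩ := hg
  obtain ⟨B, rfl⟩ := QuotientGroup.mk_surjective h
  refine ⟨B * A * B⁻¹, rfl, ?_⟩
  simpa [Matrix.inv_def] using
    (isParabolic_conj_iff (B : GL (Fin 2) ℂ) (m := (A : Matrix (Fin 2) (Fin 2) ℂ))).2 hA

theorem eq_transl {g : Moebius} (hg : g.IsParabolic)
    (h : g • (OnePoint.infty : OnePoint ℂ) = OnePoint.infty) : ∃ k ≠ 0, g = transl k := by
  obtain ⟨A, rfl, hA⟩ := hg
  rw [mk_smul, OnePoint.smul_infty_eq_self_iff] at h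
  replace h : A 1 0 = 0 := h
  obtain ⟨h1, h2⟩ := (Matrix.isParabolic_iff_of_upperTriangular h).1 hA
  have hdet : A 0 0 * A 1 1 - A 0 1 * A 1 0 = 1 := by
    rw [← Matrix.det_fin_two]; exact A.det_coe
  rw [h, mul_zero, sub_zero, ← h1] at hdet
  rw [eq_ofEntries A]
  rcases mul_self_eq_one_iff.1 hdet with h0 | h0
  · exact ⟨A 0 1, h2, by simp only [transl, ← h1, h0, h]⟩
  · refine ⟨-A 0 1, neg_ne_zero.2 h2, ?_⟩
    rw [← ofEntries_neg]
    simp only [transl, ← h1, h0, h, neg_neg, neg_zero]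

theorem exists_smul_eq_self_iff {g : Moebius} (hg : g.IsParabolic) :
    ∃ p : OnePoint ℂ, ∀ z : OnePoint ℂ, g • z = z ↔ z = p := by
  obtain ⟨A, rfl, hA⟩ := hg
  exact ⟨_, fun _ => GeneralLinearGroup.IsParabolic.smul_eq_self_iff (g := (A : GL (Fin 2) ℂ)) hA⟩

theorem exists_fixedPoint {g : Moebius} (hg : g.IsParabolic) : ∃ p : OnePoint ℂ, g • p = p :=
  let ⟨p, hp⟩ := hg.exists_smul_eq_self_iff
  ⟨p, (hp p).2 rfl⟩

theorem fixedPoint_unique {g : Moebius} (hg : g.IsParabolic) {p q : OnePoint ℂ} (hp : g • p = p)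
    (hq : g • q = q) : p = q :=
  let ⟨_, h⟩ := hg.exists_smul_eq_self_iff
  ((h p).1 hp).trans ((h q).1 hq).symm

theorem eq_conj_transl {g : Moebius} (hg : g.IsParabolic) {h : Moebius}
    (hp : g • h • (OnePoint.infty : OnePoint ℂ) = h • OnePoint.infty) :
    ∃ k ≠ 0, g = h * transl k * h⁻¹ := by
  obtain ⟨k, hk, e⟩ := (hg.conj h⁻¹).eq_transl (by simp [mul_smul, hp])
  exact ⟨k, hk, by rw [← e]; group⟩

theorem inv {g : Moebius} (hg : g.IsParabolic) : (g⁻¹).IsParabolic := by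
  obtain ⟨p, hp⟩ := hg.exists_fixedPoint
  obtain ⟨h, rfl⟩ := exists_smul_infty_eq p
  obtain ⟨k, hk, rfl⟩ := hg.eq_conj_transl hp
  rw [conj_inv, transl_inv]
  exact (isParabolic_transl (neg_ne_zero.2 hk)).conj h

theorem commute {g₁ g₂ : Moebius} (h₁ : g₁.IsParabolic) (h₂ : g₂.IsParabolic) {p : OnePoint ℂ}
    (e₁ : g₁ • p = p) (e₂ : g₂ • p = p) : Commute g₁ g₂ := by
  obtain ⟨h, rfl⟩ := exists_smul_infty_eq p
  obtain ⟨k, -, rfl⟩ := h₁.eq_conj_transl e₁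
  obtain ⟨l, -, rfl⟩ := h₂.eq_conj_transl e₂
  have hkl : Commute (transl k) (transl l) := by
    rw [Commute, SemiconjBy, transl_mul, transl_mul, add_comm]
  exact hkl.conj h

end IsParabolic

/-- Two parabolic transformations with distinct fixed points. -/
structure IsParabolicPair (S T : Moebius) : Prop where
  left : S.IsParabolic
  right : T.IsParabolic
  not_smul_eq_self : ∀ z : OnePoint ℂ, ¬ (S • z = z ∧ T • z = z)

namespace IsParabolicPair

variable {S T : Moebius}

theorem swap (H : IsParabolicPair S T) : IsParabolicPair T S where
  left := H.right
  right := H.left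
  not_smul_eq_self z hz := H.not_smul_eq_self z hz.symm

theorem inv_left (H : IsParabolicPair S T) : IsParabolicPair S⁻¹ T where
  left := H.left.inv
  right := H.right
  not_smul_eq_self z hz := H.not_smul_eq_self z ⟨(inv_smul_eq_iff.1 hz.1).symm, hz.2⟩

theorem conj (H : IsParabolicPair S T) (h : Moebius) :
    IsParabolicPair (h * S * h⁻¹) (h * T * h⁻¹) where
  left := H.left.conj h
  right := H.right.conj h
  not_smul_eq_self z hz := H.not_smul_eq_self (h⁻¹ • z) <| by
    simpa only [mul_smul, ← eq_inv_smul_iff (g := h)] using hz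

theorem not_commute (H : IsParabolicPair S T) : ¬ Commute S T := by
  intro comm
  obtain ⟨p, hp⟩ := H.left.exists_fixedPoint
  have smul_fixed : S • T • p = T • p := by rw [← mul_smul, comm.eq, mul_smul, hp]
  exact H.not_smul_eq_self p ⟨hp, H.left.fixedPoint_unique smul_fixed hp⟩

theorem exists_normal_form (H : IsParabolicPair S T) :
    ∃ (h : Moebius) (k : ℂ), S = h * transl k * h⁻¹ ∧ T = h * unitParabolic * h⁻¹ := by
  obtain ⟨p, hp⟩ := H.left.exists_fixedPoint
  obtain ⟨q, hq⟩ := H.right.exists_fixedPoint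
  have hpq : p ≠ q := by rintro rfl; exact H.not_smul_eq_self p ⟨hp, hq⟩
  obtain ⟨h, rfl, rfl⟩ := exists_smul_infty_eq_smul_zero_eq hpq
  obtain ⟨k, -, rfl⟩ := H.left.eq_conj_transl hp
  obtain ⟨l, hl, rfl⟩ := H.right.eq_conj_transl (h := h * inversion)
    (by rw [mul_smul, inversion_smul_infty, hq])
  obtain ⟨D, k', hk', hl'⟩ := exists_conj_transl_unitParabolic k hl
  refine ⟨h * D, k', ?_, ?_⟩
  · rw [hk']; group
  · calc h * inversion * transl l * (h * inversion)⁻¹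
        = h * (inversion * transl l * inversion⁻¹) * h⁻¹ := by group
      _ = h * D * unitParabolic * (h * D)⁻¹ := by rw [hl']; group

end IsParabolicPair

end Moebius

theorem exists_pos_eq_neg_smul {E : Type*} [NormedAddCommGroup E] [InnerProductSpace ℝ E]
    {x y : E} (hx : x ≠ 0) (hy : y ≠ 0) (h : ∀ d, ⟪x, d⟫_ℝ < 0 → 0 ≤ ⟪y, d⟫_ℝ) :
    ∃ σ : ℝ, 0 < σ ∧ y = -(σ • x) := by
  have hx' := norm_pos_iff.2 hx
  have hy' := norm_pos_iff.2 hy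
  have inner_le : ⟪x, y⟫_ℝ ≤ -(‖x‖ * ‖y‖) := by
    by_contra! hlt
    have hxd : ⟪x, -(‖y‖ • x + ‖x‖ • y)⟫_ℝ = -(‖x‖ * (⟪x, y⟫_ℝ + ‖x‖ * ‖y‖)) := by
      simp only [inner_neg_right, inner_add_right, real_inner_smul_right,
        real_inner_self_eq_norm_sq]
      ring
    have hyd : ⟪y, -(‖y‖ • x + ‖x‖ • y)⟫_ℝ = -(‖y‖ * (⟪x, y⟫_ℝ + ‖x‖ * ‖y‖)) := by
      simp only [inner_neg_right, inner_add_right, real_inner_smul_right,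
        real_inner_self_eq_norm_sq, real_inner_comm x y]
      ring
    have := h _ (hxd.trans_lt (neg_neg_of_pos (mul_pos hx' (by linarith))))
    rw [hyd] at this
    nlinarith
  have hle := abs_real_inner_le_norm x (-y)
  have inner_eq : ⟪x, -y⟫_ℝ = ‖x‖ * ‖-y‖ :=
    le_antisymm ((le_abs_self _).trans hle) (by rw [inner_neg_right, norm_neg]; linarith)
  rw [inner_eq_norm_mul_iff_real, norm_neg, smul_neg] at inner_eq
  refine ⟨‖y‖ / ‖x‖, by positivity, ?_⟩
  rw [div_eq_inv_mul, mul_smul, inner_eq, smul_neg, neg_neg, inv_smul_smul₀ hx'.ne']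

theorem eventually_quadratic_neg {A : ℝ} (hA : A < 0) (B C : ℝ) :
    ∀ᶠ t : ℝ in Filter.atTop, A * t ^ 2 + B * t + C < 0 := by
  filter_upwards [Filter.eventually_ge_atTop 1,
    Filter.eventually_gt_atTop ((|B| + |C|) / (-A))] with t h1 h2
  rw [div_lt_iff₀ (by linarith)] at h2
  nlinarith [le_abs_self B, le_abs_self C, abs_nonneg C]

theorem eventually_linear_neg {B : ℝ} (hB : B < 0) (C : ℝ) :
    ∀ᶠ t : ℝ in Filter.atTop, B * t + C < 0 := by
  filter_upwards [Filter.eventually_gt_atTop (C / (-B))] with t ht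
  rw [div_lt_iff₀ (by linarith)] at ht
  linarith

namespace OrientedCircle

theorem form_coe_eq_norm (C : OrientedCircle) (w : ℂ) :
    C.form w = C.a * ‖w‖ ^ 2 + 2 * ⟪C.b, w⟫_ℝ + C.c := by
  rw [← Complex.normSq_eq_norm_sq, Complex.inner, mul_comm w]
  rfl

theorem form_add_smul (C : OrientedCircle) (w d : ℂ) (t : ℝ) :
    C.form (w + t • d : ℂ) =
      C.a * ‖d‖ ^ 2 * t ^ 2 + 2 * (C.a * ⟪w, d⟫_ℝ + ⟪C.b, d⟫_ℝ) * t + C.form w := by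
  rw [form_coe_eq_norm, form_coe_eq_norm, norm_add_sq_real, norm_smul, mul_pow,
    Real.norm_eq_abs, sq_abs, inner_add_right, real_inner_smul_right, real_inner_smul_right]
  ring

theorem form_smul (C : OrientedCircle) (d : ℂ) (t : ℝ) :
    C.form (t • d : ℂ) = C.a * ‖d‖ ^ 2 * t ^ 2 + 2 * ⟪C.b, d⟫_ℝ * t + C.c := by
  simpa using C.form_add_smul 0 d t

theorem mul_lt_norm_sq (C : OrientedCircle) : C.a * C.c < ‖C.b‖ ^ 2 := by
  simpa only [Complex.normSq_eq_norm_sq] using C.nondegenerate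

theorem b_ne_zero {C : OrientedCircle} (h : C.a * C.c = 0) : C.b ≠ 0 := by
  have := C.nondegenerate
  rwa [h, Complex.normSq_pos] at this

theorem interior_nonempty (C : OrientedCircle) : C.interior.Nonempty := by
  have form_smul_b (t : ℝ) : C.form (t • C.b : ℂ) = ‖C.b‖ ^ 2 * (C.a * t ^ 2 + 2 * t) + C.c := by
    rw [form_smul, real_inner_self_eq_norm_sq]
    ring
  rcases lt_trichotomy C.a 0 with ha | ha | ha
  · exact ⟨OnePoint.infty, ha⟩
  · have hb : ‖C.b‖ ≠ 0 := norm_ne_zero_iff.2 (b_ne_zero (by rw [ha, zero_mul]))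
    refine ⟨((-((|C.c| + 1) / ‖C.b‖ ^ 2)) • C.b : ℂ), ?_⟩
    have : ‖C.b‖ ^ 2 * (2 * -((|C.c| + 1) / ‖C.b‖ ^ 2)) = -2 * (|C.c| + 1) := by
      field_simp
    rw [mem_interior, form_smul_b, ha, zero_mul, zero_add, this]
    linarith [le_abs_self C.c, abs_nonneg C.c]
  · refine ⟨((-C.a⁻¹) • C.b : ℂ), ?_⟩
    have : C.a * (-C.a⁻¹) ^ 2 + 2 * -C.a⁻¹ = -C.a⁻¹ := by
      field_simp
      ring
    rw [mem_interior, form_smul_b, this, mul_neg, neg_add_lt_iff_lt_add, add_zero,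
      ← div_eq_mul_inv, lt_div_iff₀ ha, mul_comm]
    exact C.mul_lt_norm_sq

/-- After the touching point has been moved to `∞`, all points far out on a suitable ray lie in
both interiors. -/
theorem interior_subset_exterior {X Y : OrientedCircle} (H : Disjoint X.interior Y.interior) :
    X.interior ⊆ Y.exterior := by
  intro z hz
  by_contra hz'
  have hY : Y.form z = 0 := (not_lt.1 hz').antisymm (not_lt.1 fun h => H.notMem_of_mem_left hz h)
  obtain ⟨h, rfl⟩ := Moebius.exists_smul_infty_eq z
  replace H := disjoint_comap h H
  replace hz := mem_interior_comap.2 hz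
  replace hY := form_comap_eq_zero.2 hY
  generalize X.comap h = X at *
  generalize Y.comap h = Y at *
  rw [mem_interior, form_infty] at hz
  rw [form_infty] at hY
  have hb : Y.b ≠ 0 := b_ne_zero (by rw [hY, zero_mul])
  have hb' : 0 < ‖-Y.b‖ ^ 2 := by simpa using pow_pos (norm_pos_iff.2 hb) 2
  have hbb : 2 * ⟪Y.b, -Y.b⟫_ℝ < 0 := by
    rw [inner_neg_right, real_inner_self_eq_norm_sq, ← norm_neg]
    linarith
  obtain ⟨t, hX, hY'⟩ := ((eventually_quadratic_neg (mul_neg_of_neg_of_pos hz hb') _ X.c).and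
    (eventually_linear_neg hbb Y.c)).exists
  refine Disjoint.notMem_of_mem_left H (a := ((t • -Y.b : ℂ) : OnePoint ℂ)) ?_ ?_
  · rwa [mem_interior, form_smul]
  · rwa [mem_interior, form_smul, hY, zero_mul, zero_mul, zero_add]

theorem exterior_subset_exterior {X Y : OrientedCircle} (H : X.interior ⊆ Y.interior) :
    Y.exterior ⊆ X.exterior := by
  rw [← interior_flip Y]
  apply interior_subset_exterior
  rw [interior_flip, Set.disjoint_left]
  exact fun z hz hz' => lt_asymm (mem_exterior.1 hz) (H hz')

theorem exterior_eq_of_interior_eq {X Y : OrientedCircle} (H : X.interior = Y.interior) :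
    X.exterior = Y.exterior :=
  (exterior_subset_exterior H.ge).antisymm (exterior_subset_exterior H.le)

/-- With `p` and `q` moved to `∞` and `0` the circles `X` and `Y` become lines through `0`, so that
the negative of an interior point of `Z` lies in both of their interiors. -/
theorem touching_point_unique {X Y Z : OrientedCircle} (hXY : Disjoint X.interior Y.interior)
    (hZX : Disjoint Z.interior X.interior) (hZY : Disjoint Z.interior Y.interior)
    {p q : OnePoint ℂ} (hXp : X.form p = 0) (hYp : Y.form p = 0) (hXq : X.form q = 0)
    (hYq : Y.form q = 0) : p = q := by
  by_contra hpq
  obtain ⟨h, rfl, rfl⟩ := Moebius.exists_smul_infty_eq_smul_zero_eq hpq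
  replace hXY := disjoint_comap h hXY
  replace hZX := interior_subset_exterior (disjoint_comap h hZX)
  replace hZY := interior_subset_exterior (disjoint_comap h hZY)
  rw [← form_comap_eq_zero] at hXp hXq hYp hYq
  generalize X.comap h = X at *
  generalize Y.comap h = Y at *
  rw [form_infty] at hXp hYp
  rw [form_zero] at hXq hYq
  obtain ⟨z, hz⟩ := (Z.comap h).interior_nonempty
  induction z using OnePoint.rec with
  | infty => exact (mem_exterior.1 (hZX hz)).ne' hXp
  | coe w =>
    have neg_mem_interior {D : OrientedCircle} (ha : D.a = 0) (hc : D.c = 0)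
        (hw : (w : OnePoint ℂ) ∈ D.exterior) : ((-w : ℂ) : OnePoint ℂ) ∈ D.interior := by
      rw [mem_exterior, form_coe_eq_norm] at hw
      rw [mem_interior, form_coe_eq_norm, norm_neg, inner_neg_right]
      linarith [mul_eq_zero_of_left ha (‖w‖ ^ 2)]
    exact Set.disjoint_left.1 hXY (neg_mem_interior hXp hXq (hZX hz))
      (neg_mem_interior hYp hYq (hZY hz))

theorem exists_b_eq_neg_smul {X Y : OrientedCircle} (hX : X.c = 0) (hY : Y.c = 0)
    (H : Disjoint X.interior Y.interior) : ∃ σ : ℝ, 0 < σ ∧ Y.b = -(σ • X.b) := by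
  have eventually_mem {C : OrientedCircle} (hC : C.c = 0) {d : ℂ} (hd : ⟪C.b, d⟫_ℝ < 0) :
      ∀ᶠ t : ℝ in Filter.atTop, ((t⁻¹ • d : ℂ) : OnePoint ℂ) ∈ C.interior := by
    filter_upwards [eventually_linear_neg (mul_neg_of_pos_of_neg two_pos hd) (C.a * ‖d‖ ^ 2),
      Filter.eventually_gt_atTop 0] with t ht ht0
    rw [mem_interior, form_smul, hC]
    field_simp
    linarith
  refine exists_pos_eq_neg_smul (b_ne_zero (by rw [hX, mul_zero]))
    (b_ne_zero (by rw [hY, mul_zero])) fun d hXd => ?_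
  by_contra! hYd
  obtain ⟨t, hXt, hYt⟩ := ((eventually_mem hX hXd).and (eventually_mem hY hYd)).exists
  exact Set.disjoint_left.1 H hXt hYt

/-- The orbit of a point of `D` under a parabolic transformation converges to the fixed point,
and it leaves `D` if the fixed point lies outside. -/
theorem form_fixedPoint_nonpos {D : OrientedCircle} {g : Moebius} (hg : g.IsParabolic)
    {p : OnePoint ℂ} (hp : g • p = p) (H : Set.MapsTo (g • ·) D.interior D.interior) :
    D.form p ≤ 0 := by
  by_contra! hpos
  obtain ⟨h, rfl⟩ := Moebius.exists_smul_infty_eq p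
  obtain ⟨k, hk, rfl⟩ := hg.eq_conj_transl hp
  replace hpos := mem_exterior_comap.2 hpos
  replace H : Set.MapsTo (Moebius.transl k • ·) (D.comap h).interior (D.comap h).interior := by
    intro z hz
    rw [mem_interior_comap] at hz ⊢
    simpa [mul_smul] using H hz
  generalize D.comap h = D at *
  rw [mem_exterior, form_infty] at hpos
  obtain ⟨z, hz⟩ := D.interior_nonempty
  induction z using OnePoint.rec with
  | infty => exact lt_asymm hz hpos
  | coe w =>
    have orbit_mem (n : ℕ) : ((w + (n : ℝ) • k : ℂ) : OnePoint ℂ) ∈ D.interior := by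
      induction n with
      | zero => simpa using hz
      | succ n ih =>
        simpa [Moebius.transl_smul_coe, add_mul, add_assoc] using H ih
    have hA : -(D.a * ‖k‖ ^ 2) < 0 := neg_neg_of_pos (by positivity)
    obtain ⟨n, hn⟩ := (tendsto_natCast_atTop_atTop.eventually (eventually_quadratic_neg hA
      (-(2 * (D.a * ⟪w, k⟫_ℝ + ⟪D.b, k⟫_ℝ))) (-D.form w))).exists
    have := mem_interior.1 (orbit_mem n)
    rw [form_add_smul] at this
    linarith

theorem mapsTo_inv_smul {D E : OrientedCircle} {g : Moebius}
    (H : Set.MapsTo (g • ·) E.exterior D.interior) :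
    Set.MapsTo (g⁻¹ • ·) D.exterior E.interior := by
  intro z hz
  have : E.flip.interior ⊆ (D.comap g).interior := by
    rwa [interior_flip, interior_comap]
  rw [← exterior_flip]
  exact exterior_subset_exterior this (mem_exterior_comap.2 (by rwa [smul_inv_smul]))

theorem form_fixedPoint_eq_zero {D E : OrientedCircle} {g : Moebius} (hg : g.IsParabolic)
    {p : OnePoint ℂ} (hp : g • p = p) (hDE : Disjoint D.interior E.interior)
    (H : Set.MapsTo (g • ·) E.exterior D.interior) : D.form p = 0 ∧ E.form p = 0 := by
  have hDE' := interior_subset_exterior hDE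
  have hED := interior_subset_exterior hDE.symm
  have hD : D.form p ≤ 0 := form_fixedPoint_nonpos hg hp (H.mono_left hDE')
  have hE : E.form p ≤ 0 := form_fixedPoint_nonpos hg.inv (inv_smul_eq_iff.2 hp.symm)
    ((mapsTo_inv_smul H).mono_left hED)
  exact ⟨hD.antisymm (not_lt.1 fun h => hE.not_gt (hDE' h)),
    hE.antisymm (not_lt.1 fun h => hD.not_gt (hED h))⟩

end OrientedCircle

open OrientedCircle

/-- `g` maps the exterior of `A` onto the interior of `A'`. -/
def PairsSides (g : Moebius) (A A' : OrientedCircle) : Prop :=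
  (fun z => g • z) '' A.exterior = A'.interior

namespace PairsSides

variable {g : Moebius} {A A' : OrientedCircle}

theorem iff_forall : PairsSides g A A' ↔ ∀ z, g • z ∈ A'.interior ↔ z ∈ A.exterior := by
  rw [PairsSides, Set.image_smul, Set.ext_iff, (MulAction.surjective g).forall]
  simp only [Set.smul_mem_smul_set_iff]
  exact forall_congr' fun _ => iff_comm

theorem smul_mem_interior (h : PairsSides g A A') {z : OnePoint ℂ} :
    g • z ∈ A'.interior ↔ z ∈ A.exterior :=
  iff_forall.1 h z

theorem interior_comap_eq (h : PairsSides g A A') : (A'.comap g).interior = A.flip.interior := by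
  ext z
  rw [mem_interior_comap, h.smul_mem_interior, interior_flip]

theorem inv (h : PairsSides g A A') : PairsSides g⁻¹ A' A := by
  refine iff_forall.2 fun z => ?_
  rw [← exterior_flip, ← exterior_eq_of_interior_eq h.interior_comap_eq, mem_exterior_comap,
    smul_inv_smul]

theorem comap (H : PairsSides g A A') (h : Moebius) :
    PairsSides (h⁻¹ * g * h) (A.comap h) (A'.comap h) := by
  refine iff_forall.2 fun z => ?_
  rw [mem_interior_comap, mem_exterior_comap, ← H.smul_mem_interior]
  simp [mul_smul]

theorem of_comapSL_eq_flip {M : Matrix.SpecialLinearGroup (Fin 2) ℂ}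
    (h : A'.comapSL M = A.flip) : PairsSides (QuotientGroup.mk M) A A' := by
  refine iff_forall.2 fun z => ?_
  obtain ⟨r, hr, e⟩ := A'.form_comapSL M z
  rw [h, form_flip] at e
  rw [mem_exterior, mem_interior, ← neg_neg_iff_pos, e]
  exact (smul_neg_iff_of_pos_left hr).symm

end PairsSides

/-- The sides of the circles `A`, `A'` are paired by `S` and those of `B`, `B'` by `T`, and the four
interiors are disjoint. -/
structure PairsFourCircles (S T : Moebius) (A A' B B' : OrientedCircle) : Prop where
  disjoint_A_A' : Disjoint A.interior A'.interior
  disjoint_A_B : Disjoint A.interior B.interior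
  disjoint_A_B' : Disjoint A.interior B'.interior
  disjoint_A'_B : Disjoint A'.interior B.interior
  disjoint_A'_B' : Disjoint A'.interior B'.interior
  disjoint_B_B' : Disjoint B.interior B'.interior
  pairsSides_left : PairsSides S A A'
  pairsSides_right : PairsSides T B B'

namespace PairsFourCircles

variable {S T : Moebius} {A A' B B' : OrientedCircle}

theorem swap (h : PairsFourCircles S T A A' B B') : PairsFourCircles T S B B' A A' where
  disjoint_A_A' := h.disjoint_B_B'
  disjoint_A_B := h.disjoint_A_B.symm
  disjoint_A_B' := h.disjoint_A'_B.symm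
  disjoint_A'_B := h.disjoint_A_B'.symm
  disjoint_A'_B' := h.disjoint_A'_B'.symm
  disjoint_B_B' := h.disjoint_A_A'
  pairsSides_left := h.pairsSides_right
  pairsSides_right := h.pairsSides_left

theorem inv_left (h : PairsFourCircles S T A A' B B') : PairsFourCircles S⁻¹ T A' A B B' where
  disjoint_A_A' := h.disjoint_A_A'.symm
  disjoint_A_B := h.disjoint_A'_B
  disjoint_A_B' := h.disjoint_A'_B'
  disjoint_A'_B := h.disjoint_A_B
  disjoint_A'_B' := h.disjoint_A_B'
  disjoint_B_B' := h.disjoint_B_B'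
  pairsSides_left := h.pairsSides_left.inv
  pairsSides_right := h.pairsSides_right

theorem comap (H : PairsFourCircles S T A A' B B') (h : Moebius) :
    PairsFourCircles (h⁻¹ * S * h) (h⁻¹ * T * h) (A.comap h) (A'.comap h) (B.comap h)
      (B'.comap h) where
  disjoint_A_A' := disjoint_comap h H.disjoint_A_A'
  disjoint_A_B := disjoint_comap h H.disjoint_A_B
  disjoint_A_B' := disjoint_comap h H.disjoint_A_B'
  disjoint_A'_B := disjoint_comap h H.disjoint_A'_B
  disjoint_A'_B' := disjoint_comap h H.disjoint_A'_B'
  disjoint_B_B' := disjoint_comap h H.disjoint_B_B'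
  pairsSides_left := H.pairsSides_left.comap h
  pairsSides_right := H.pairsSides_right.comap h

end PairsFourCircles

/-- `S` and `T` form a classical T-Schottky configuration with suitable circles. -/
def IsSchottkyPair (S T : Moebius) : Prop :=
  ∃ A A' B B' : OrientedCircle, PairsFourCircles S T A A' B B'

theorem isMarkedClassicalTSchottky_closure_pair {S T : Moebius} (h : IsSchottkyPair S T) :
    IsMarkedClassicalTSchottky (Subgroup.closure {S, T}) ![S, T] := by
  obtain ⟨A, A', B, B', h⟩ := h
  refine ⟨by simp [Matrix.range_cons, Set.pair_comm], ![A, B], ![A', B'], ⟨?_, ?_⟩⟩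
  · have := h.disjoint_A_A'
    have := h.disjoint_A_B
    have := h.disjoint_A_B'
    have := h.disjoint_A'_B
    have := h.disjoint_A'_B'
    have := h.disjoint_B_B'
    rintro (i | i) (j | j) hij <;> fin_cases i <;> fin_cases j <;>
      first
      | exact absurd rfl hij
      | assumption
      | exact Disjoint.symm ‹_›
  · exact Fin.forall_fin_two.2 ⟨h.pairsSides_left, h.pairsSides_right⟩

namespace IsSchottkyPair

variable {S T : Moebius}

theorem swap : IsSchottkyPair S T → IsSchottkyPair T S :=
  fun ⟨_, _, _, _, h⟩ => ⟨_, _, _, _, h.swap⟩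

theorem inv_left : IsSchottkyPair S T → IsSchottkyPair S⁻¹ T :=
  fun ⟨_, _, _, _, h⟩ => ⟨_, _, _, _, h.inv_left⟩

theorem conj (h : Moebius) : IsSchottkyPair S T → IsSchottkyPair (h * S * h⁻¹) (h * T * h⁻¹) :=
  fun ⟨_, _, _, _, H⟩ => ⟨_, _, _, _, by simpa only [inv_inv] using H.comap h⁻¹⟩

end IsSchottkyPair

namespace OrientedCircle

/-- The line of points `z` with `⟪d, z⟫ + s = 0`, together with `∞`. -/
noncomputable def line (d : ℂ) (hd : d ≠ 0) (s : ℝ) : OrientedCircle :=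
  ⟨0, (2⁻¹ : ℝ) • d, s, by simpa [Complex.normSq_pos] using hd⟩

/-- The circle (a line if `p = 0`) of points `z` with `p ‖z‖ ^ 2 + ⟪d, z⟫ = 0`; it passes through
`0` perpendicularly to `d`. -/
noncomputable def circleThroughZero (p : ℝ) (d : ℂ) (hd : d ≠ 0) : OrientedCircle :=
  ⟨p, (2⁻¹ : ℝ) • d, 0, by simpa [Complex.normSq_pos] using hd⟩

variable {p s s' : ℝ} {d e k : ℂ}

@[simp]
theorem form_line_infty (hd : d ≠ 0) : (line d hd s).form OnePoint.infty = 0 :=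
  form_infty _

@[simp]
theorem form_line_coe (hd : d ≠ 0) (z : ℂ) : (line d hd s).form z = ⟪d, z⟫_ℝ + s := by
  simp only [form_coe_eq_norm, line, real_inner_smul_left]
  ring

@[simp]
theorem form_circleThroughZero_infty (hd : d ≠ 0) :
    (circleThroughZero p d hd).form OnePoint.infty = p :=
  form_infty _

@[simp]
theorem form_circleThroughZero_coe (hd : d ≠ 0) (z : ℂ) :
    (circleThroughZero p d hd).form z = p * ‖z‖ ^ 2 + ⟪d, z⟫_ℝ := by
  simp only [form_coe_eq_norm, circleThroughZero, real_inner_smul_left]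
  ring

theorem disjoint_line_neg (hd : d ≠ 0) (hs : 0 ≤ s) :
    Disjoint (line d hd s).interior (line (-d) (neg_ne_zero.2 hd) s).interior := by
  rw [Set.disjoint_left]
  intro z hz hz'
  rw [mem_interior] at hz hz'
  induction z using OnePoint.rec with
  | infty => exact hz.ne (form_line_infty hd)
  | coe z =>
    rw [form_line_coe] at hz hz'
    rw [inner_neg_left] at hz'
    linarith

theorem disjoint_circleThroughZero_neg (hd : d ≠ 0) (hp : 0 ≤ p) :
    Disjoint (circleThroughZero p d hd).interior
      (circleThroughZero p (-d) (neg_ne_zero.2 hd)).interior := by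
  rw [Set.disjoint_left]
  intro z hz hz'
  rw [mem_interior] at hz hz'
  induction z using OnePoint.rec with
  | infty => exact hp.not_gt ((form_circleThroughZero_infty hd).symm.trans_lt hz)
  | coe z =>
    rw [form_circleThroughZero_coe] at hz hz'
    rw [inner_neg_left] at hz'
    linarith [mul_nonneg hp (sq_nonneg ‖z‖)]

theorem disjoint_line_circleThroughZero (he : e ≠ 0) (hd : d ≠ 0) (hp : 0 < p)
    (h : ⟪e, d⟫_ℝ + ‖e‖ * ‖d‖ ≤ 2 * p * s) :
    Disjoint (line e he s).interior (circleThroughZero p d hd).interior := by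
  rw [Set.disjoint_left]
  intro z hz hz'
  rw [mem_interior] at hz hz'
  induction z using OnePoint.rec with
  | infty => exact hz.ne (form_line_infty he)
  | coe z =>
    rw [form_line_coe] at hz
    rw [form_circleThroughZero_coe] at hz'
    have norm_lt : ‖(2 * p) • z + d‖ < ‖d‖ := by
      refine lt_of_pow_lt_pow_left₀ 2 (norm_nonneg d) ?_
      rw [norm_add_sq_real, norm_smul, mul_pow, Real.norm_eq_abs, sq_abs, real_inner_smul_left,
        real_inner_comm]
      nlinarith
    have inner_ge := neg_le_of_abs_le ((abs_real_inner_le_norm e ((2 * p) • z + d)).trans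
      (mul_le_mul_of_nonneg_left norm_lt.le (norm_nonneg e)))
    rw [inner_add_right, real_inner_smul_right] at inner_ge
    nlinarith

theorem pairsSides_transl_line (hd : d ≠ 0) (h : s + s' = ⟪d, k⟫_ℝ) :
    PairsSides (Moebius.transl k) (line d hd s) (line (-d) (neg_ne_zero.2 hd) s') := by
  refine PairsSides.iff_forall.2 fun z => ?_
  rw [mem_interior, mem_exterior]
  induction z using OnePoint.rec with
  | infty => rw [Moebius.transl_smul_infty, form_line_infty, form_line_infty]
  | coe z =>
    rw [Moebius.transl_smul_coe, form_line_coe, form_line_coe, inner_neg_left, inner_add_right,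
      ← h]
    constructor <;> intro <;> linarith

theorem pairsSides_unitParabolic_circleThroughZero (hd : d ≠ 0) (h : d.re = 2 * p) :
    PairsSides Moebius.unitParabolic (circleThroughZero p d hd)
      (circleThroughZero p (-d) (neg_ne_zero.2 hd)) := by
  refine PairsSides.of_comapSL_eq_flip ?_
  rw [comapSL, flip, mk.injEq]
  refine ⟨?_, Complex.ext ?_ ?_, ?_⟩
  · simp [circleThroughZero, Moebius.matrixOf, herm, h]
    ring
  all_goals simp [circleThroughZero, Moebius.matrixOf, herm]

end OrientedCircle

/-- The lines perpendicular to `I * μ` through `± k / 2` bound a strip containing the two circles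
of diameter `2 / μ.re` that touch at `0` perpendicularly to `μ`. -/
theorem isSchottkyPair_transl_unitParabolic_of_unit {k μ : ℂ} (hμ : ‖μ‖ = 1) (hre : 0 < μ.re)
    (h : 2 ≤ μ.re * ⟪Complex.I * μ, k⟫_ℝ) :
    IsSchottkyPair (Moebius.transl k) Moebius.unitParabolic := by
  have hμ0 : μ ≠ 0 := norm_ne_zero_iff.1 (by rw [hμ]; exact one_ne_zero)
  have hν0 : Complex.I * μ ≠ 0 := mul_ne_zero Complex.I_ne_zero hμ0
  have hν : ‖Complex.I * μ‖ = 1 := by rw [norm_mul, Complex.norm_I, one_mul, hμ]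
  have inner_eq_zero : ⟪Complex.I * μ, μ⟫_ℝ = 0 := by
    simp [Complex.inner, mul_comm]
  set W := ⟪Complex.I * μ, k⟫_ℝ
  have hW : 0 < W := pos_of_mul_pos_right (two_pos.trans_le h) hre.le
  have width : 1 ≤ 2 * (μ.re / 2) * (W / 2) := by linarith
  refine ⟨line _ hν0 (W / 2), line _ (neg_ne_zero.2 hν0) (W / 2),
    circleThroughZero (μ.re / 2) μ hμ0, circleThroughZero (μ.re / 2) (-μ) (neg_ne_zero.2 hμ0),
    disjoint_line_neg _ (by positivity), ?_, ?_, ?_, ?_,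
    disjoint_circleThroughZero_neg _ (by positivity), pairsSides_transl_line _ (add_halves W),
    pairsSides_unitParabolic_circleThroughZero _ (by ring)⟩ <;>
  · refine disjoint_line_circleThroughZero _ _ (by positivity) ?_
    simpa [inner_neg_left, inner_neg_right, inner_eq_zero, hμ, hν] using width

open scoped ComplexConjugate in
theorem exists_unit_two_le_re_mul_inner {k : ℂ} (hk : 4 ≤ ‖k‖ + k.im) :
    ∃ μ : ℂ, ‖μ‖ = 1 ∧ 0 < μ.re ∧ 2 ≤ μ.re * ⟪Complex.I * μ, k⟫_ℝ := by
  have hk0 : k ≠ 0 := by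
    rintro rfl
    norm_num at hk
  obtain ⟨m, hm⟩ := IsAlgClosed.exists_pow_nat_eq (Complex.I * ‖k‖ / k) two_pos
  have norm_eq : ‖m‖ = 1 := by
    rw [← pow_eq_one_iff_of_nonneg (norm_nonneg m) two_ne_zero, ← norm_pow, hm]
    simp [hk0]
  have normSq_eq : m.re * m.re + m.im * m.im = 1 := by
    rw [← Complex.normSq_apply, Complex.normSq_eq_norm_sq, norm_eq, one_pow]
  have im_eq : (m ^ 2 * k).im = ‖k‖ := by
    rw [hm, div_mul_cancel₀ _ hk0]
    simp
  have inner_eq : ⟪Complex.I * conj m, k⟫_ℝ = (m * k).im := by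
    simp only [Complex.inner, map_mul, Complex.conj_I, Complex.conj_conj]
    rw [mul_left_comm, mul_comm k]
    simp
  have two_le : 2 ≤ (conj m).re * ⟪Complex.I * conj m, k⟫_ℝ := by
    rw [inner_eq, Complex.conj_re]
    simp only [sq, Complex.mul_im, Complex.mul_re] at im_eq ⊢
    linear_combination hk / 2 - im_eq / 2 - k.im * normSq_eq / 2
  rcases lt_trichotomy m.re 0 with hre | hre | hre
  · refine ⟨-conj m, by simpa using norm_eq, by simpa using hre, ?_⟩
    rwa [mul_neg, inner_neg_left, Complex.neg_re, neg_mul_neg]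
  · rw [Complex.conj_re, hre] at two_le
    norm_num at two_le
  · exact ⟨conj m, by simpa using norm_eq, hre, two_le⟩

theorem isSchottkyPair_transl_unitParabolic {k : ℂ} (hk : 4 ≤ ‖k‖ + |k.im|) :
    IsSchottkyPair (Moebius.transl k) Moebius.unitParabolic := by
  wlog him : 0 ≤ k.im generalizing k
  · have := (this (k := -k) (by simpa using hk) (by simpa using (not_le.1 him).le)).inv_left
    rwa [Moebius.transl_inv, neg_neg] at this
  rw [abs_of_nonneg him] at hk
  obtain ⟨μ, hμ, hre, h⟩ := exists_unit_two_le_re_mul_inner hk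
  exact isSchottkyPair_transl_unitParabolic_of_unit hμ hre h

open scoped ComplexConjugate in
theorem inner_inv_right_complex (e w : ℂ) : ⟪e, w⁻¹⟫_ℝ = ⟪conj e, w⟫_ℝ * ‖w⁻¹‖ ^ 2 := by
  rw [norm_inv, inv_pow, ← Complex.normSq_eq_norm_sq, Complex.inner, Complex.inner, Complex.inv_def,
    Complex.conj_conj, mul_right_comm, Complex.re_mul_ofReal, ← Complex.conj_re, map_mul,
    Complex.conj_conj, Complex.conj_conj]

/-- The disc `a ‖z‖ ^ 2 + ⟪e, z⟫ < 0` has diameter `1 / a` in the direction of `e`. -/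
theorem pos_and_one_le_mul_of_forall_inner_ge {E : Type*} [NormedAddCommGroup E]
    [InnerProductSpace ℝ E] {e : E} (he : ‖e‖ = 1) {a W : ℝ}
    (H : ∀ z : E, a * ‖z‖ ^ 2 + ⟪e, z⟫_ℝ < 0 → -W ≤ ⟪e, z⟫_ℝ) : 0 < W ∧ 1 ≤ a * W := by
  have le_of_mul_lt {t : ℝ} (ht : 0 < t) (hat : a * t < 1) : t ≤ W := by
    have := H (-(t • e))
    rw [norm_neg, norm_smul, he, inner_neg_right, real_inner_smul_right,
      real_inner_self_eq_norm_sq, he, mul_one, one_pow, mul_one, Real.norm_eq_abs, sq_abs] at this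
    linarith [this (by nlinarith)]
  have one_le {V : ℝ} (hV : 0 ≤ V) (hWV : W ≤ V) : 1 ≤ a * V := by
    by_contra! h
    have : ∀ᶠ t in nhds V, a * t < 1 :=
      (continuous_const_mul a).continuousAt.eventually_lt continuousAt_const h
    obtain ⟨t, hVt, hat⟩ := (frequently_gt_nhds V).and_eventually this |>.exists
    linarith [le_of_mul_lt (hV.trans_lt hVt) hat]
  have hW : 0 < W := by
    by_contra! hW
    linarith [one_le le_rfl hW]
  exact ⟨hW, one_le hW.le le_rfl⟩

theorem mul_norm_sq_add_inner_neg_iff {E : Type*} [NormedAddCommGroup E] [InnerProductSpace ℝ E]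
    {e : E} (he : ‖e‖ = 1) {a : ℝ} (ha : 0 < a) (z : E) :
    a * ‖z‖ ^ 2 + ⟪e, z⟫_ℝ < 0 ↔ z ∈ Metric.ball (-((2 * a)⁻¹ • e)) (2 * a)⁻¹ := by
  have : ‖z + (2 * a)⁻¹ • e‖ ^ 2 = a⁻¹ • (a * ‖z‖ ^ 2 + ⟪e, z⟫_ℝ) + ((2 * a)⁻¹) ^ 2 := by
    rw [norm_add_sq_real, norm_smul, he, real_inner_smul_right, real_inner_comm, mul_one,
      Real.norm_eq_abs, sq_abs, smul_eq_mul]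
    field_simp
  rw [mem_ball_iff_norm, sub_neg_eq_add, ← sq_lt_sq₀ (norm_nonneg _) (by positivity), this,
    add_lt_iff_neg_right, smul_neg_iff_of_pos_left (inv_pos.2 ha)]

theorem inv_add_inv_mul_inner_le_of_disjoint {E : Type*} [NormedAddCommGroup E]
    [InnerProductSpace ℝ E] {e k : E} (he : ‖e‖ = 1) {a₀ a₁ : ℝ} (h₀ : 0 < a₀) (h₁ : 0 < a₁)
    (H : ∀ z : E, a₀ * ‖z - k‖ ^ 2 + ⟪e, z - k⟫_ℝ < 0 → 0 ≤ a₁ * ‖z‖ ^ 2 + ⟪-e, z⟫_ℝ) :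
    (a₀⁻¹ + a₁⁻¹) * ⟪e, k⟫_ℝ ≤ ‖k‖ ^ 2 := by
  have disjoint_balls : Disjoint (Metric.ball (k - (2 * a₀)⁻¹ • e) (2 * a₀)⁻¹)
      (Metric.ball (-((2 * a₁)⁻¹ • -e)) (2 * a₁)⁻¹) := by
    refine Set.disjoint_left.2 fun z hz₀ hz₁ => (H z ?_).not_gt ?_
    · rw [mul_norm_sq_add_inner_neg_iff he h₀]
      rwa [mem_ball_iff_norm, sub_neg_eq_add, sub_add, ← mem_ball_iff_norm]
    · rwa [mul_norm_sq_add_inner_neg_iff (by rwa [norm_neg]) h₁]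
  rw [disjoint_ball_ball_iff (by positivity) (by positivity), dist_eq_norm, smul_neg, neg_neg,
    sub_sub, ← add_smul, ← sq_le_sq₀ (by positivity) (norm_nonneg _), norm_sub_sq_real, norm_smul,
    he, real_inner_smul_right, real_inner_comm, Real.norm_eq_abs, mul_one, sq_abs] at disjoint_balls
  rw [mul_inv, mul_inv] at disjoint_balls
  linarith

open scoped ComplexConjugate in
/-- In the coordinate `1 / z` the map `z ↦ z / (z + 1)` is `w ↦ w + 1` and the two circles are
parallel lines. -/
theorem add_le_re_of_forall {e : ℂ} (he : ‖e‖ = 1) {a₀ a₁ : ℝ}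
    (H : ∀ z : ℂ, z + 1 ≠ 0 → 0 < a₀ * ‖z‖ ^ 2 + ⟪e, z⟫_ℝ →
      a₁ * ‖z / (z + 1)‖ ^ 2 + ⟪-e, z / (z + 1)⟫_ℝ < 0) : a₀ + a₁ ≤ e.re := by
  have normSq_eq : e.re * e.re + e.im * e.im = 1 := by
    rw [← Complex.normSq_apply, Complex.normSq_eq_norm_sq, he, one_pow]
  by_contra! hlt
  obtain ⟨r, hr₀, hr₁⟩ := exists_between (show -a₀ < a₁ - e.re by linarith)
  set w : ℂ := conj e * ⟨r, 2⟩ with hw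
  have norm_w : ‖w‖ ^ 2 = r ^ 2 + 4 := by
    rw [hw, norm_mul, Complex.norm_conj, he, one_mul, ← Complex.normSq_eq_norm_sq,
      Complex.normSq_apply]
    ring
  have inner_w : ⟪conj e, w⟫_ℝ = r := by
    simp only [hw, Complex.inner, Complex.mul_re, Complex.mul_im, Complex.conj_re, Complex.conj_im]
    linear_combination r * normSq_eq
  have inner_w_one : ⟪conj e, w + 1⟫_ℝ = r + e.re := by
    rw [inner_add_right, inner_w]
    simp [Complex.inner]
  have hw0 : w ≠ 0 := by
    intro h
    rw [h, norm_zero] at norm_w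
    nlinarith
  have hw1 : w + 1 ≠ 0 := by
    intro h
    rw [eq_neg_of_add_eq_zero_left h, norm_neg, norm_one] at norm_w
    nlinarith
  have inv_add_one : w⁻¹ + 1 = (w + 1) / w := by
    field_simp
    ring
  have := H w⁻¹ (by rw [inv_add_one]; exact div_ne_zero hw1 hw0) (by
    rw [inner_inv_right_complex, inner_w, ← add_mul]
    exact mul_pos (by linarith) (pow_pos (norm_pos_iff.2 (inv_ne_zero hw0)) 2))
  rw [inv_add_one, inv_div_left, div_mul_cancel₀ _ hw0, inner_neg_left,
    inner_inv_right_complex, inner_w_one, ← sub_eq_add_neg, ← sub_mul] at this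
  exact this.not_ge (mul_nonneg (by linarith) (by positivity))

theorem four_le_norm_add_abs_im {e k : ℂ} (he : ‖e‖ = 1) (hpos : 0 < ⟪e, k⟫_ℝ)
    (h2 : 2 ≤ e.re * ⟪e, k⟫_ℝ) (h4 : 4 * ⟪e, k⟫_ℝ ≤ ‖k‖ ^ 2 * e.re) : 4 ≤ ‖k‖ + |k.im| := by
  rcases le_total 4 |k.im| with hy | hy
  · linarith [norm_nonneg k]
  have normSq_e : e.re * e.re + e.im * e.im = 1 := by
    rw [← Complex.normSq_apply, Complex.normSq_eq_norm_sq, he, one_pow]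
  rw [← Complex.normSq_eq_norm_sq, Complex.normSq_apply] at h4
  have inner_eq : ⟪e, k⟫_ℝ = e.re * k.re + e.im * k.im := by
    simp [Complex.inner]
    ring
  set W := ⟪e, k⟫_ℝ
  obtain ⟨τ, hτ⟩ : ∃ τ, W * τ = e.re * k.im - e.im * k.re :=
    ⟨_, mul_div_cancel₀ _ hpos.ne'⟩
  have re_eq : k.re = e.re * W * (1 + τ ^ 2) - τ * k.im := by
    refine mul_left_cancel₀ hpos.ne' ?_
    linear_combination (k.im - e.re * (W * τ + e.re * k.im - e.im * k.re)) * hτ +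
      (k.re - e.re * (W + e.re * k.re + e.im * k.im)) * inner_eq -
      e.re * (k.re ^ 2 + k.im ^ 2) * normSq_e
  have normSq_k : k.re * k.re + k.im * k.im = W ^ 2 * (1 + τ ^ 2) := by
    linear_combination -(W * τ + e.re * k.im - e.im * k.re) * hτ -
      (W + e.re * k.re + e.im * k.im) * inner_eq - (k.re ^ 2 + k.im ^ 2) * normSq_e
  have four_le : 4 ≤ e.re * W * (1 + τ ^ 2) := by
    refine le_of_mul_le_mul_left ?_ hpos
    rw [normSq_k] at h4
    linarith
  have two_le := mul_le_mul_of_nonneg_right h2 (by positivity : 0 ≤ 1 + τ ^ 2)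
  have hτy : τ * k.im ≤ |τ| * |k.im| := (le_abs_self _).trans_eq (abs_mul _ _)
  have sub_le_re : 4 - |k.im| ≤ k.re := by
    rcases le_total |τ| 1 with hle | hle
    · nlinarith [abs_nonneg k.im]
    · nlinarith [mul_nonneg (sub_nonneg.2 hle) (by linarith : 0 ≤ 2 * |τ| + 2 - |k.im|), sq_abs τ]
  linarith [Complex.re_le_norm k]

namespace OrientedCircle

theorem interior_eq_circleThroughZero {C : OrientedCircle} (hc : C.c = 0) {β : ℝ} (hβ : 0 < β)
    {e : ℂ} (he : e ≠ 0) (hb : C.b = β • e) :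
    C.interior = (circleThroughZero (C.a / (2 * β)) e he).interior := by
  have form_eq (z : OnePoint ℂ) :
      C.form z = (2 * β) • (circleThroughZero (C.a / (2 * β)) e he).form z := by
    rw [smul_eq_mul]
    induction z using OnePoint.rec with
    | infty => rw [form_infty, form_circleThroughZero_infty, mul_div_cancel₀ _ (by positivity)]
    | coe w =>
      rw [form_circleThroughZero_coe, form_coe_eq_norm, hb, hc, real_inner_smul_left]
      field_simp
      ring
  ext z
  rw [mem_interior, mem_interior, form_eq, smul_neg_iff_of_pos_left (by positivity)]

end OrientedCircle

theorem four_le_norm_add_abs_im_of_forall {e k : ℂ} (he : ‖e‖ = 1) {a₀ a₁ : ℝ}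
    (h₀ : ∀ z : ℂ, a₀ * ‖z‖ ^ 2 + ⟪e, z⟫_ℝ < 0 → 0 ≤ ⟪e, z + k⟫_ℝ)
    (h₁ : ∀ z : ℂ, a₁ * ‖z‖ ^ 2 + ⟪-e, z⟫_ℝ < 0 → ⟪e, z - k⟫_ℝ ≤ 0)
    (H : ∀ z : ℂ, a₀ * ‖z - k‖ ^ 2 + ⟪e, z - k⟫_ℝ < 0 → 0 ≤ a₁ * ‖z‖ ^ 2 + ⟪-e, z⟫_ℝ)
    (hU : ∀ z : ℂ, z + 1 ≠ 0 → 0 < a₀ * ‖z‖ ^ 2 + ⟪e, z⟫_ℝ →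
      a₁ * ‖z / (z + 1)‖ ^ 2 + ⟪-e, z / (z + 1)⟫_ℝ < 0) : 4 ≤ ‖k‖ + |k.im| := by
  set W := ⟪e, k⟫_ℝ
  obtain ⟨hpos, one_le₀⟩ : 0 < W ∧ 1 ≤ a₀ * W :=
    pos_and_one_le_mul_of_forall_inner_ge he fun z hz => by
      have := h₀ z hz
      rw [inner_add_right] at this
      linarith
  obtain ⟨-, one_le₁⟩ : 0 < W ∧ 1 ≤ a₁ * W :=
    pos_and_one_le_mul_of_forall_inner_ge ((norm_neg e).trans he) fun z hz => by
      have := h₁ z hz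
      rw [inner_sub_right] at this
      rw [inner_neg_left]
      linarith
  have ha₀ : 0 < a₀ := pos_of_mul_pos_left (one_pos.trans_le one_le₀) hpos.le
  have ha₁ : 0 < a₁ := pos_of_mul_pos_left (one_pos.trans_le one_le₁) hpos.le
  have add_le := add_le_re_of_forall he hU
  have inner_le := inv_add_inv_mul_inner_le_of_disjoint he ha₀ ha₁ H
  have four_le : 4 ≤ (a₀⁻¹ + a₁⁻¹) * (a₀ + a₁) := by
    have : (a₀⁻¹ + a₁⁻¹) * (a₀ + a₁) = (a₀ - a₁) ^ 2 / (a₀ * a₁) + 4 := by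
      field_simp
      ring
    rw [this]
    exact le_add_of_nonneg_left (by positivity)
  refine four_le_norm_add_abs_im he hpos ?_ ?_
  · calc 2 ≤ (a₀ + a₁) * W := by linarith
      _ ≤ e.re * W := by gcongr
  · calc 4 * W ≤ (a₀⁻¹ + a₁⁻¹) * (a₀ + a₁) * W := by gcongr
      _ ≤ (a₀⁻¹ + a₁⁻¹) * e.re * W := by gcongr
      _ = (a₀⁻¹ + a₁⁻¹) * W * e.re := by ring
      _ ≤ ‖k‖ ^ 2 * e.re := by gcongr; linarith

namespace PairsFourCircles

variable {k : ℂ} {A A' B B' : OrientedCircle}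

theorem disjoint_flip_A_comap_B {S T : Moebius} (H : PairsFourCircles S T A A' B B') :
    Disjoint A.flip.interior (B.comap S).interior := by
  rw [← H.pairsSides_left.interior_comap_eq]
  exact disjoint_comap _ H.disjoint_A'_B

/-- All four circles pass through fixed points: `A` through the fixed point `∞` of `transl k`,
and `A`, `B'` and the translate of `B` through the fixed point `0` of `unitParabolic`. -/
theorem coeff_eq_zero (hk : (Moebius.transl k).IsParabolic)
    (H : PairsFourCircles (Moebius.transl k)
      (Moebius.unitParabolic * (Moebius.transl k)⁻¹) A A' B B') :
    A.a = 0 ∧ A.c = 0 ∧ B'.c = 0 ∧ (B.comap (Moebius.transl k)).c = 0 := by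
  have mapsTo_left : Set.MapsTo (Moebius.transl k • ·) A.exterior A'.interior :=
    fun z hz => H.pairsSides_left.smul_mem_interior.2 hz
  have mapsTo_right : Set.MapsTo (Moebius.unitParabolic • ·) (B.comap (Moebius.transl k)).exterior
      B'.interior := fun z hz => by
    simpa [mul_smul] using H.pairsSides_right.smul_mem_interior.2 (mem_exterior_comap.1 hz)
  obtain ⟨-, hA⟩ := form_fixedPoint_eq_zero hk (Moebius.transl_smul_infty k)
    H.disjoint_A_A'.symm mapsTo_left
  obtain ⟨hB', hA'⟩ := form_fixedPoint_eq_zero Moebius.isParabolic_unitParabolic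
    Moebius.unitParabolic_smul_zero H.disjoint_A_B'.symm (mapsTo_right.comp fun z hz =>
      mem_exterior_comap.2 (interior_subset_exterior H.disjoint_A'_B (mapsTo_left hz)))
  obtain ⟨-, hB⟩ := form_fixedPoint_eq_zero Moebius.isParabolic_unitParabolic
    Moebius.unitParabolic_smul_zero H.disjoint_flip_A_comap_B fun z hz => by
      rw [interior_flip]
      exact interior_subset_exterior H.disjoint_A_B'.symm (mapsTo_right hz)
  simp only [form_infty, form_zero] at hA hA' hB hB'
  exact ⟨hA, hA', hB', hB⟩

theorem exists_circleThroughZero (hk : (Moebius.transl k).IsParabolic)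
    (H : PairsFourCircles (Moebius.transl k)
      (Moebius.unitParabolic * (Moebius.transl k)⁻¹) A A' B B') :
    ∃ (e : ℂ) (he : e ≠ 0) (a₀ a₁ : ℝ), ‖e‖ = 1 ∧
      A.interior = (circleThroughZero 0 e he).interior ∧
      (B.comap (Moebius.transl k)).interior = (circleThroughZero a₀ e he).interior ∧
      B'.interior = (circleThroughZero a₁ (-e) (neg_ne_zero.2 he)).interior := by
  obtain ⟨hAa, hAc, hB'c, hBc⟩ := H.coeff_eq_zero hk
  obtain ⟨σ₁, hσ₁, hb₁⟩ := exists_b_eq_neg_smul hAc hB'c H.disjoint_A_B'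
  obtain ⟨σ₀, hσ₀, hb₀⟩ := exists_b_eq_neg_smul (X := A.flip) (by simp [OrientedCircle.flip, hAc])
    hBc H.disjoint_flip_A_comap_B
  have hρ : 0 < ‖A.b‖ := norm_pos_iff.2 (b_ne_zero (by rw [hAa, zero_mul]))
  obtain ⟨e, he, hb⟩ : ∃ e, ‖e‖ = 1 ∧ A.b = ‖A.b‖ • e :=
    ⟨‖A.b‖⁻¹ • A.b, by rw [norm_smul, norm_inv, norm_norm, inv_mul_cancel₀ hρ.ne'],
      (smul_inv_smul₀ hρ.ne' _).symm⟩
  have he0 : e ≠ 0 := norm_ne_zero_iff.1 (by rw [he]; exact one_ne_zero)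
  refine ⟨e, he0, _, _, he, ?_,
    interior_eq_circleThroughZero hBc (mul_pos hσ₀ hρ) he0 ?_,
    interior_eq_circleThroughZero hB'c (mul_pos hσ₁ hρ) (neg_ne_zero.2 he0) ?_⟩
  · simpa [hAa] using interior_eq_circleThroughZero hAc hρ he0 hb
  · rw [hb₀, mul_smul, ← hb]
    simp [OrientedCircle.flip]
  · rw [hb₁, smul_neg, mul_smul, ← hb]

end PairsFourCircles

theorem four_le_norm_add_abs_im_of_isSchottkyPair {k : ℂ} (hk : (Moebius.transl k).IsParabolic)
    (H : IsSchottkyPair (Moebius.transl k) (Moebius.unitParabolic * (Moebius.transl k)⁻¹)) :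
    4 ≤ ‖k‖ + |k.im| := by
  obtain ⟨A, A', B, B', H⟩ := H
  obtain ⟨e, he0, a₀, a₁, he, hA, hB₀, hB'⟩ := H.exists_circleThroughZero hk
  have coe_mem_A {z : ℂ} : (z : OnePoint ℂ) ∈ A.interior ↔ ⟪e, z⟫_ℝ < 0 := by
    rw [hA, mem_interior, form_circleThroughZero_coe, zero_mul, zero_add]
  have coe_mem_A' {z : ℂ} : (z : OnePoint ℂ) ∈ A'.interior ↔ 0 < ⟪e, z - k⟫_ℝ := by
    rw [← sub_add_cancel z k, ← Moebius.transl_smul_coe, H.pairsSides_left.smul_mem_interior,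
      exterior_eq_of_interior_eq hA, mem_exterior, form_circleThroughZero_coe, zero_mul, zero_add,
      add_sub_cancel_right]
  have coe_mem_B {z : ℂ} :
      (z : OnePoint ℂ) ∈ B.interior ↔ a₀ * ‖z - k‖ ^ 2 + ⟪e, z - k⟫_ℝ < 0 := by
    rw [← sub_add_cancel z k, ← Moebius.transl_smul_coe, ← mem_interior_comap, hB₀, mem_interior,
      form_circleThroughZero_coe, add_sub_cancel_right]
  have coe_mem_B' {z : ℂ} :
      (z : OnePoint ℂ) ∈ B'.interior ↔ a₁ * ‖z‖ ^ 2 + ⟪-e, z⟫_ℝ < 0 := by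
    rw [hB', mem_interior, form_circleThroughZero_coe]
  refine four_le_norm_add_abs_im_of_forall he (a₀ := a₀) (a₁ := a₁) (fun z hz => ?_)
    (fun z hz => ?_) (fun z hz => ?_) fun z hz1 hz => ?_
  · refine not_lt.1 fun h => H.disjoint_A_B.notMem_of_mem_left (coe_mem_A.2 h) (coe_mem_B.2 ?_)
    rwa [add_sub_cancel_right]
  · exact not_lt.1 fun h =>
      H.disjoint_A'_B'.notMem_of_mem_left (coe_mem_A'.2 h) (coe_mem_B'.2 hz)
  · exact not_lt.1 fun h => H.disjoint_B_B'.notMem_of_mem_left (coe_mem_B.2 hz) (coe_mem_B'.2 h)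
  · rw [← coe_mem_B', ← Moebius.unitParabolic_smul_coe z hz1,
      ← inv_smul_smul (Moebius.transl k) (z : OnePoint ℂ), ← mul_smul,
      H.pairsSides_right.smul_mem_interior, ← mem_exterior_comap, exterior_eq_of_interior_eq hB₀]
    rwa [mem_exterior, form_circleThroughZero_coe]

namespace IsSchottkyPair

variable {a b : Moebius}

theorem mul_right (H : IsSchottkyPair a b) (hpar : Moebius.IsParabolicPair a (b * a)) :
    IsSchottkyPair a (b * a) := by
  obtain ⟨h, k, a_eq, ba_eq⟩ := hpar.exists_normal_form
  have hk : (Moebius.transl k).IsParabolic := by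
    have := hpar.left.conj h⁻¹
    rwa [a_eq, inv_inv, mul_assoc, inv_mul_cancel_right, inv_mul_cancel_left] at this
  have b_eq : b = h * (Moebius.unitParabolic * (Moebius.transl k)⁻¹) * h⁻¹ := by
    rw [eq_mul_inv_of_mul_eq ba_eq, a_eq]
    group
  have H' := H.conj h⁻¹
  rw [b_eq, a_eq] at H'
  simp only [mul_assoc, inv_mul_cancel_left, inv_mul_cancel, mul_one, inv_inv] at H'
  have := (isSchottkyPair_transl_unitParabolic
    (four_le_norm_add_abs_im_of_isSchottkyPair hk H')).conj h
  rwa [← a_eq, ← ba_eq] at this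

/-- The circles of `a` would touch at the fixed point of `a` and at the fixed point of
`a * (b * a ^ n) * a⁻¹`, which are distinct. -/
theorem not_isParabolicPair_mul_pow (H : IsSchottkyPair a b) {n : ℕ} (hn : 2 ≤ n) :
    ¬ Moebius.IsParabolicPair a (b * a ^ n) := by
  intro hpar
  obtain ⟨A, A', B, B', H⟩ := H
  have mapsTo_a : Set.MapsTo (a • ·) A.exterior A'.interior :=
    fun z hz => H.pairsSides_left.smul_mem_interior.2 hz
  have mapsTo_b : Set.MapsTo (b • ·) B.exterior B'.interior :=
    fun z hz => H.pairsSides_right.smul_mem_interior.2 hz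
  have mapsTo_pow (m : ℕ) : Set.MapsTo (a ^ (m + 1) • ·) A.exterior A'.interior := by
    induction m with
    | zero => simpa using mapsTo_a
    | succ m ih =>
      intro z hz
      simp only [pow_succ' a (m + 1), mul_smul]
      exact mapsTo_a (interior_subset_exterior H.disjoint_A_A'.symm (ih hz))
  obtain ⟨p, hp⟩ := hpar.left.exists_fixedPoint
  obtain ⟨q, hq⟩ := hpar.right.exists_fixedPoint
  obtain ⟨hA'p, hAp⟩ := form_fixedPoint_eq_zero hpar.left hp H.disjoint_A_A'.symm mapsTo_a
  obtain ⟨n, rfl⟩ := Nat.exists_eq_add_of_le' hn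
  have conj_eq : a * (b * a ^ (n + 2)) * a⁻¹ = a * (b * a ^ (n + 1)) := by
    rw [pow_succ a (n + 1)]
    group
  have mapsTo_conj : Set.MapsTo ((a * (b * a ^ (n + 2)) * a⁻¹) • ·) A.exterior A'.interior := by
    intro z hz
    simp only [conj_eq, mul_smul]
    exact mapsTo_a (interior_subset_exterior H.disjoint_A_B'.symm
      (mapsTo_b (interior_subset_exterior H.disjoint_A'_B (mapsTo_pow n hz))))
  have conj_smul : (a * (b * a ^ (n + 2)) * a⁻¹) • a • q = a • q := by
    rw [mul_smul, inv_smul_smul, mul_smul, hq]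
  obtain ⟨hA'q, hAq⟩ :=
    form_fixedPoint_eq_zero (hpar.right.conj a) conj_smul H.disjoint_A_A'.symm mapsTo_conj
  have smul_p_eq : a • p = a • q := hp.trans <| touching_point_unique H.disjoint_A_A'
    H.disjoint_A_B.symm H.disjoint_A'_B.symm hAp hA'p hAq hA'q
  exact hpar.not_smul_eq_self p ⟨hp, (smul_left_cancel a smul_p_eq).symm ▸ hq⟩

theorem mul_pow (H : IsSchottkyPair a b) (n : ℕ)
    (hpar : Moebius.IsParabolicPair a (b * a ^ n)) : IsSchottkyPair a (b * a ^ n) := by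
  match n with
  | 0 => simpa using H
  | 1 =>
    rw [pow_one] at *
    exact H.mul_right hpar
  | n + 2 => exact absurd hpar (H.not_isParabolicPair_mul_pow (Nat.le_add_left 2 n))

theorem mul_zpow (H : IsSchottkyPair a b) (n : ℤ)
    (hpar : Moebius.IsParabolicPair a (b * a ^ n)) : IsSchottkyPair a (b * a ^ n) := by
  obtain ⟨n, rfl | rfl⟩ := n.eq_nat_or_neg
  · rw [zpow_natCast] at *
    exact H.mul_pow n hpar
  · rw [zpow_neg, zpow_natCast, ← inv_pow] at hpar ⊢
    simpa only [inv_inv] using (H.inv_left.mul_pow n hpar.inv_left).inv_left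

theorem zpow_mul_mul_zpow (H : IsSchottkyPair a b) (m n : ℤ)
    (hpar : Moebius.IsParabolicPair a (a ^ m * b * a ^ n)) :
    IsSchottkyPair a (a ^ m * b * a ^ n) := by
  have hpar' : Moebius.IsParabolicPair a (b * a ^ (n + m)) := by
    convert hpar.conj (a ^ m)⁻¹ using 1 <;> group
  convert (H.mul_zpow (n + m) hpar').conj (a ^ m) using 1 <;> group

end IsSchottkyPair

section BasisCompletion

open FreeGroup (of mk)

variable {α : Type*}

theorem exists_mk_singleton_eq_zpow (x : α × Bool) :
    ∃ e : ℤ, mk [x] = of x.1 ^ e ∧ of x.1 = mk [x] ^ e := by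
  obtain ⟨i, _ | _⟩ := x
  · exact ⟨-1, by rw [zpow_neg_one]; rfl, by rw [zpow_neg_one]; rfl⟩
  · exact ⟨1, (zpow_one _).symm, (zpow_one _).symm⟩

section DecidableEq

variable [DecidableEq α] {i : α} {v : FreeGroup α}

theorem forall_mem_head?_toWord_inv {v : FreeGroup α} :
    (∀ x ∈ v⁻¹.toWord.head?, x.1 ≠ i) ↔ ∀ x ∈ v.toWord.getLast?, x.1 ≠ i := by
  simp only [FreeGroup.toWord_inv, FreeGroup.invRev, List.head?_reverse, List.getLast?_map,
    Option.forall_mem_map]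

theorem toWord_pow_succ (v : FreeGroup α) (n : ℕ) : ∃ c k : List (α × Bool),
    v.toWord = c ++ k ++ FreeGroup.invRev c ∧
      (v ^ (n + 1)).toWord = c ++ (List.replicate (n + 1) k).flatten ++ FreeGroup.invRev c :=
  ⟨_, _, (FreeGroup.reduceCyclically.conj_conjugator_reduceCyclically _).symm,
    (FreeGroup.toWord_pow v (n + 1)).trans
      (FreeGroup.reduceCyclically.reduce_flatten_replicate_succ FreeGroup.isReduced_toWord n)⟩

theorem head?_toWord_pow_succ (v : FreeGroup α) (n : ℕ) :
    (v ^ (n + 1)).toWord.head? = v.toWord.head? := by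
  obtain ⟨c, k, v_eq, pow_eq⟩ := toWord_pow_succ v n
  rw [v_eq, pow_eq]
  cases c <;> cases k <;> simp [List.replicate_succ]

theorem norm_le_norm_pow_succ (v : FreeGroup α) (n : ℕ) : v.norm ≤ (v ^ (n + 1)).norm := by
  obtain ⟨c, k, v_eq, pow_eq⟩ := toWord_pow_succ v n
  rw [FreeGroup.norm, FreeGroup.norm, v_eq, pow_eq]
  simp [List.replicate_succ]

theorem toWord_mul_of_fst_ne {x y : FreeGroup α}
    (h : ∀ a ∈ x.toWord.getLast?, ∀ b ∈ y.toWord.head?, a.1 ≠ b.1) :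
    (x * y).toWord = x.toWord ++ y.toWord := by
  rw [FreeGroup.toWord_mul]
  exact FreeGroup.IsReduced.reduce_eq <| List.isChain_append.2
    ⟨FreeGroup.isReduced_toWord, FreeGroup.isReduced_toWord,
      fun a ha b hb fst_eq => absurd fst_eq (h a ha b hb)⟩

theorem fst_eq_of_mem_toWord_of_zpow {n : ℤ} {x : α × Bool} (hx : x ∈ (of i ^ n).toWord) :
    x.1 = i := by
  obtain ⟨m, rfl | rfl⟩ := n.eq_nat_or_neg
  · rw [zpow_natCast, FreeGroup.toWord_of_pow] at hx
    rw [List.eq_of_mem_replicate hx]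
  · rw [zpow_neg, zpow_natCast, FreeGroup.toWord_inv, FreeGroup.toWord_of_pow] at hx
    simp only [FreeGroup.invRev, List.map_replicate, List.reverse_replicate] at hx
    rw [List.eq_of_mem_replicate hx]

theorem toWord_of_zpow_mul {x : FreeGroup α} (hx : ∀ a ∈ x.toWord.head?, a.1 ≠ i) (m : ℤ) :
    (of i ^ m * x).toWord = (of i ^ m).toWord ++ x.toWord := by
  refine toWord_mul_of_fst_ne fun a ha b hb => ?_
  rw [fst_eq_of_mem_toWord_of_zpow (List.mem_of_mem_getLast? ha)]
  exact (hx b hb).symm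

/-- An element whose reduced word starts and ends with letters other than `i` and has at least two
letters, so that no cancellation between its powers and those of `i` is possible. The last letter
is encoded as the first one of the inverse. -/
structure IsLongBlock (i : α) (v : FreeGroup α) : Prop where
  head_ne : ∀ x ∈ v.toWord.head?, x.1 ≠ i
  head_inv_ne : ∀ x ∈ v⁻¹.toWord.head?, x.1 ≠ i
  two_le_norm : 2 ≤ v.norm

namespace IsLongBlock

theorem inv (h : IsLongBlock i v) : IsLongBlock i v⁻¹ where
  head_ne := h.head_inv_ne
  head_inv_ne := by simpa only [inv_inv] using h.head_ne
  two_le_norm := by simpa only [FreeGroup.norm_inv_eq] using h.two_le_norm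

theorem pow_succ (h : IsLongBlock i v) (n : ℕ) : IsLongBlock i (v ^ (n + 1)) where
  head_ne := by simpa only [head?_toWord_pow_succ] using h.head_ne
  head_inv_ne := by simpa only [← inv_pow, head?_toWord_pow_succ] using h.head_inv_ne
  two_le_norm := h.two_le_norm.trans (norm_le_norm_pow_succ v n)

theorem zpow (h : IsLongBlock i v) {n : ℤ} (hn : n ≠ 0) : IsLongBlock i (v ^ n) := by
  obtain ⟨m, rfl | rfl⟩ := n.eq_nat_or_neg
  · obtain ⟨m, rfl⟩ := Nat.exists_eq_add_one_of_ne_zero (by simpa using hn)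
    rw [zpow_natCast]
    exact h.pow_succ m
  · obtain ⟨m, rfl⟩ := Nat.exists_eq_add_one_of_ne_zero (by simpa using hn)
    rw [zpow_neg, zpow_natCast]
    exact (h.pow_succ m).inv

end IsLongBlock

/-- `x` is a product `v ^ e₁ * a ^ m₁ * ⋯ * v ^ eₖ * a ^ mₖ` in which only the last exponent `mₖ`
may be zero. -/
inductive IsAlternating {G : Type*} [Group G] (a v : G) : G → Prop
  | one : IsAlternating a v 1
  | step (e m : ℤ) (x : G) : e ≠ 0 → (m = 0 → x = 1) → IsAlternating a v x →
      IsAlternating a v (v ^ e * (a ^ m * x))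

theorem IsAlternating.exists_zpow_mul_eq {G : Type*} [Group G] {a v x : G}
    (hx : IsAlternating a v x) (e m : ℤ) :
    ∃ (n : ℤ) (y : G), IsAlternating a v y ∧ v ^ e * (a ^ m * x) = a ^ n * y := by
  by_cases he : e = 0
  · exact ⟨m, x, hx, by rw [he, zpow_zero, one_mul]⟩
  by_cases hm : m = 0
  · subst hm
    cases hx with
    | one => exact ⟨0, _, .step e 0 1 he (fun _ => rfl) .one, by simp⟩
    | step f n y hf hy alt_y =>
      by_cases hef : e + f = 0
      · exact ⟨n, y, alt_y, by rw [zpow_zero, one_mul, ← mul_assoc, ← zpow_add, hef, zpow_zero,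
          one_mul]⟩
      · exact ⟨0, _, .step (e + f) n y hef hy alt_y, by
          rw [zpow_zero, one_mul, one_mul, zpow_add, mul_assoc]⟩
  · exact ⟨0, _, .step e m x he (fun h => absurd h hm) hx, by rw [zpow_zero, one_mul]⟩

theorem exists_isAlternating_of_mem_closure {G : Type*} [Group G] {a v g : G}
    (hg : g ∈ Subgroup.closure {a, v}) :
    ∃ (m : ℤ) (x : G), IsAlternating a v x ∧ g = a ^ m * x := by
  induction hg using Subgroup.closure_induction_left with
  | one => exact ⟨0, 1, .one, by simp⟩
  | mul_left b hb y _ ih =>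
    obtain ⟨m, x, hx, rfl⟩ := ih
    obtain rfl | rfl := hb
    · exact ⟨m + 1, x, hx, by rw [← mul_assoc, zpow_add_one, mul_self_zpow, zpow_add_one]⟩
    · simpa only [zpow_one] using hx.exists_zpow_mul_eq 1 m
  | inv_mul_cancel b hb y _ ih =>
    obtain ⟨m, x, hx, rfl⟩ := ih
    obtain rfl | rfl := hb
    · exact ⟨-1 + m, x, hx, by rw [zpow_add, zpow_neg_one, mul_assoc]⟩
    · simpa only [zpow_neg_one] using hx.exists_zpow_mul_eq (-1) m

theorem IsAlternating.head_ne_and_eq_one_or_two_le_norm (hv : IsLongBlock i v) {x : FreeGroup α}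
    (hx : IsAlternating (of i) v x) :
    (∀ a ∈ x.toWord.head?, a.1 ≠ i) ∧ (x = 1 ∨ 2 ≤ x.norm) := by
  induction hx with
  | one => simp
  | step e m x he hm _ ih =>
    have head_eq : ∀ b ∈ (of i ^ m * x).toWord.head?, b.1 = i := by
      intro b hb
      rw [toWord_of_zpow_mul ih.1] at hb
      by_cases hm0 : m = 0
      · simp [hm0, hm hm0] at hb
      · rw [List.head?_append_of_ne_nil _
          (by simpa [FreeGroup.toWord_eq_nil_iff] using hm0)] at hb
        exact fst_eq_of_mem_toWord_of_zpow (List.mem_of_mem_head? hb)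
    have block := hv.zpow he
    have word_eq : (v ^ e * (of i ^ m * x)).toWord = (v ^ e).toWord ++ (of i ^ m * x).toWord :=
      toWord_mul_of_fst_ne fun a ha b hb =>
        head_eq b hb ▸ forall_mem_head?_toWord_inv.1 block.head_inv_ne a ha
    have two_le := block.two_le_norm
    rw [FreeGroup.norm] at two_le ⊢
    rw [word_eq, List.head?_append_of_ne_nil _ (List.ne_nil_of_length_pos (by omega)),
      List.length_append]
    exact ⟨block.head_ne, .inr (by omega)⟩

theorem not_isLongBlock_of_closure_eq_top [Nontrivial α]
    (h : Subgroup.closure {of i, v} = ⊤) : ¬ IsLongBlock i v := by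
  intro hv
  obtain ⟨j, hj⟩ := exists_ne i
  obtain ⟨m, x, hx, of_eq⟩ :=
    exists_isAlternating_of_mem_closure (h ▸ Subgroup.mem_top (of j))
  obtain ⟨head_ne, norm_x⟩ :=
    hx.head_ne_and_eq_one_or_two_le_norm hv
  have word_eq := congrArg FreeGroup.toWord of_eq
  rw [FreeGroup.toWord_of, toWord_of_zpow_mul head_ne] at word_eq
  obtain rfl | two_le := norm_x
  · rw [mul_one] at of_eq
    have mem : (j, true) ∈ (of i ^ m).toWord := by simp [← of_eq]
    exact hj (fst_eq_of_mem_toWord_of_zpow mem)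
  · have := congrArg List.length word_eq
    rw [FreeGroup.norm] at two_le
    simp only [List.length_singleton, List.length_append] at this
    omega

theorem exists_norm_zpow_mul_lt {v : FreeGroup α} {x : α × Bool} (hx : x ∈ v.toWord.head?) :
    ∃ e : ℤ, (of x.1 ^ e * v).norm < v.norm := by
  obtain ⟨L, hL⟩ := List.head?_eq_some_iff.1 hx
  have v_eq : v = mk [x] * mk L := by rw [FreeGroup.mul_mk, List.singleton_append, ← hL,
    FreeGroup.mk_toWord]
  have lt : ((mk [x])⁻¹ * v).norm < v.norm := by
    calc ((mk [x])⁻¹ * v).norm = (mk L).norm := by rw [v_eq, inv_mul_cancel_left]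
      _ ≤ L.length := FreeGroup.norm_mk_le
      _ < v.norm := by rw [FreeGroup.norm, hL]; exact Nat.lt_succ_self _
  obtain ⟨e, mk_eq, -⟩ := exists_mk_singleton_eq_zpow x
  exact ⟨-e, by rwa [zpow_neg, ← mk_eq]⟩

/-- Take `v` of minimal norm in the double coset of `w`. -/
theorem exists_eq_zpow_mul_mul_zpow (i : α) (w : FreeGroup α) :
    ∃ (m n : ℤ) (v : FreeGroup α), w = of i ^ m * v * of i ^ n ∧
      (∀ x ∈ v.toWord.head?, x.1 ≠ i) ∧ ∀ x ∈ v⁻¹.toWord.head?, x.1 ≠ i := by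
  let f : ℤ × ℤ → ℕ := fun p => (of i ^ p.1 * w * of i ^ p.2).norm
  obtain ⟨⟨m, n⟩, hmin⟩ : ∃ p, ∀ q, f p ≤ f q := ⟨_, fun q => Function.argmin_le f q⟩
  refine ⟨-m, -n, of i ^ m * w * of i ^ n, by group, ?_, ?_⟩
  · rintro x hx rfl
    obtain ⟨e, he⟩ := exists_norm_zpow_mul_lt hx
    refine he.not_ge ((hmin (e + m, n)).trans_eq ?_)
    simp only [f, zpow_add, mul_assoc]
  · rintro x hx rfl
    obtain ⟨e, he⟩ := exists_norm_zpow_mul_lt hx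
    rw [FreeGroup.norm_inv_eq, ← FreeGroup.norm_inv_eq (x := of x.1 ^ e * _)] at he
    refine he.not_ge ((hmin (m, n - e)).trans_eq ?_)
    simp only [f, zpow_sub, mul_inv_rev, inv_inv, mul_assoc]

end DecidableEq

theorem exists_eq_zpow_mul_mk_mul_zpow_of [Nontrivial α] {i : α} {w : FreeGroup α}
    (h : Subgroup.closure {of i, w} = ⊤) :
    ∃ (m n : ℤ) (y : α × Bool), y.1 ≠ i ∧ w = of i ^ m * mk [y] * of i ^ n := by
  classical
  obtain ⟨m, n, v, rfl, head_ne, head_inv_ne⟩ := exists_eq_zpow_mul_mul_zpow i w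
  have closure_v : Subgroup.closure {of i, v} = ⊤ := by
    rw [eq_top_iff, ← h, Subgroup.closure_le]
    have of_mem : of i ∈ Subgroup.closure {of i, v} := Subgroup.subset_closure (.inl rfl)
    rintro x (rfl | rfl)
    · exact of_mem
    · exact mul_mem (mul_mem (zpow_mem of_mem m) (Subgroup.subset_closure (.inr rfl)))
        (zpow_mem of_mem n)
  have norm_lt : v.norm < 2 := by
    by_contra! two_le
    exact not_isLongBlock_of_closure_eq_top closure_v ⟨head_ne, head_inv_ne, two_le⟩
  match hL : v.toWord with
  | [] =>
    obtain ⟨j, hj⟩ := exists_ne i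
    rw [FreeGroup.toWord_eq_nil_iff] at hL
    rw [hL, Set.pair_comm, Subgroup.closure_insert_one] at closure_v
    obtain ⟨k, hk⟩ := Subgroup.mem_closure_singleton.1 (closure_v ▸ Subgroup.mem_top (of j))
    have mem : (j, true) ∈ (of i ^ k).toWord := by simp [hk]
    exact absurd (fst_eq_of_mem_toWord_of_zpow mem) hj
  | [y] => exact ⟨m, n, y, head_ne y (by simp [hL]), by rw [← hL, FreeGroup.mk_toWord]⟩
  | x :: y :: L => simp [FreeGroup.norm, hL] at norm_lt

theorem exists_eq_zpow_mul_mk_mul_zpow [Nontrivial α] {x : α × Bool} {w : FreeGroup α}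
    (h : Subgroup.closure {mk [x], w} = ⊤) :
    ∃ (m n : ℤ) (y : α × Bool), y.1 ≠ x.1 ∧ w = mk [x] ^ m * mk [y] * mk [x] ^ n := by
  obtain ⟨e, mk_eq, of_eq⟩ := exists_mk_singleton_eq_zpow x
  have closure_eq : Subgroup.closure {of x.1, w} = ⊤ := by
    rw [eq_top_iff, ← h, Subgroup.closure_le]
    rintro g (rfl | rfl)
    · exact mk_eq ▸ zpow_mem (Subgroup.subset_closure (.inl rfl)) e
    · exact Subgroup.subset_closure (.inr rfl)
  obtain ⟨m, n, y, hy, rfl⟩ := exists_eq_zpow_mul_mk_mul_zpow_of closure_eq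
  exact ⟨e * m, e * n, y, hy, by rw [zpow_mul, zpow_mul, ← of_eq]⟩

end BasisCompletion

section ExponentSums

variable {α : Type*}

section DecidableEq

variable [DecidableEq α]

/-- The exponent sums of the generators in an element of a free group: the abelianization map. -/
def exponentSum : FreeGroup α →* Multiplicative (α → ℤ) :=
  FreeGroup.lift fun i => Multiplicative.ofAdd (Pi.single i 1)

theorem exponentSum_conj (c s : FreeGroup α) : exponentSum (c * s * c⁻¹) = exponentSum s := by
  rw [map_mul, map_mul, map_inv, mul_right_comm, mul_inv_cancel, one_mul]

theorem span_exponentSum_eq_top [Finite α] {ι : Type*} {g : ι → FreeGroup α}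
    (h : Subgroup.closure (Set.range g) = ⊤) :
    Submodule.span ℤ (Set.range fun i => (exponentSum (g i)).toAdd) = ⊤ := by
  set N := Submodule.span ℤ (Set.range fun i => (exponentSum (g i)).toAdd)
  have mem (s : FreeGroup α) : (exponentSum s).toAdd ∈ N := by
    have hs : s ∈ Subgroup.closure (Set.range g) := h ▸ Subgroup.mem_top s
    induction hs using Subgroup.closure_induction with
    | mem x hx =>
      obtain ⟨i, rfl⟩ := hx
      exact Submodule.subset_span ⟨i, rfl⟩
    | one => simp
    | mul x y _ _ hx hy => simpa using add_mem hx hy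
    | inv x _ hx => simpa using hx
  rw [eq_top_iff, ← (Pi.basisFun ℤ α).span_eq, Submodule.span_le]
  rintro _ ⟨i, rfl⟩
  simpa [exponentSum] using mem (FreeGroup.of i)

theorem isUnit_det_exponentSum [Fintype α] {g : α → FreeGroup α}
    (h : Subgroup.closure (Set.range g) = ⊤) :
    IsUnit (Matrix.of fun i => (exponentSum (g i)).toAdd).det := by
  rw [← Matrix.isUnit_iff_isUnit_det, ← Matrix.vecMul_surjective_iff_isUnit]
  have := (range_vecMulLinear (Matrix.of fun i => (exponentSum (g i)).toAdd)).trans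
    (span_exponentSum_eq_top h)
  exact LinearMap.range_eq_top.1 this

end DecidableEq

theorem card_le_card_of_closure_range_eq_top [Fintype α] {ι : Type*} [Fintype ι]
    {g : ι → FreeGroup α} (h : Subgroup.closure (Set.range g) = ⊤) :
    Fintype.card α ≤ Fintype.card ι := by
  classical
  have := finrank_range_le_card (R := ℤ) fun i => (exponentSum (g i)).toAdd
  rwa [Set.finrank, span_exponentSum_eq_top h, finrank_top, Module.finrank_fintype_fun_eq_card]
    at this

end ExponentSums

theorem quaternion_conj_eq_or_eq_inv (c x : QuaternionGroup 2) :
    c * x * c⁻¹ = x ∨ c * x * c⁻¹ = x⁻¹ := by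
  revert c x
  decide

/-- Map `FreeGroup α` onto a non-abelian subgroup of the quaternion group, where every conjugate
of `x` is `x` or `x⁻¹`. -/
theorem not_commute_conj_of_closure_eq_top {α : Type*} [Nontrivial α] {s t : FreeGroup α}
    (h : Subgroup.closure {s, t} = ⊤) (c d : FreeGroup α) :
    ¬ Commute (c * s * c⁻¹) (d * t * d⁻¹) := by
  classical
  intro comm
  obtain ⟨i, j, hij⟩ := exists_pair_ne α
  let φ : FreeGroup α →* QuaternionGroup 2 :=
    FreeGroup.lift fun k => if k = i then .a 1 else .xa 0
  have comm_st : Commute (φ s) (φ t) := by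
    have := comm.map φ
    simp only [map_mul, map_inv] at this
    obtain hs | hs := quaternion_conj_eq_or_eq_inv (φ c) (φ s) <;>
      obtain ht | ht := quaternion_conj_eq_or_eq_inv (φ d) (φ t) <;>
      rw [hs, ht] at this
    · exact this
    · exact Commute.inv_right_iff.1 this
    · exact Commute.inv_left_iff.1 this
    · exact Commute.inv_left_iff.1 (Commute.inv_right_iff.1 this)
  have comm_range (x y : FreeGroup α) : Commute (φ x) (φ y) := by
    have hx : x ∈ Subgroup.closure {s, t} := h ▸ Subgroup.mem_top x
    have hy : y ∈ Subgroup.closure {s, t} := h ▸ Subgroup.mem_top y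
    induction hx, hy using Subgroup.closure_induction₂ with
    | mem x y hx hy =>
      obtain rfl | rfl := hx <;> obtain rfl | rfl := hy
      exacts [.refl _, comm_st, comm_st.symm, .refl _]
    | one_left y => simp
    | one_right x => simp
    | mul_left x y z _ _ _ hx hy => simpa using hx.mul_left hy
    | mul_right x y z _ _ _ hx hy => simpa using hx.mul_right hy
    | inv_left x y _ _ hx => simpa using hx
    | inv_right x y _ _ hx => simpa using hx
  have : Commute (QuaternionGroup.a 1 : QuaternionGroup 2) (QuaternionGroup.xa 0) := by
    simpa [φ, hij.symm] using comm_range (.of i) (.of j)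
  exact absurd this.eq (by decide)

section WhiteheadGraph

open FreeGroup (of mk IsCyclicallyReduced)

variable {α : Type*} {L M : List (α × Bool)}

/-- The inverse of a letter of a word in a free group. -/
def letterInv (x : α × Bool) : α × Bool := (x.1, !x.2)

/-- The edges of the Whitehead graph of the cyclic word `L`: each pair of cyclically consecutive
letters `y`, `x` contributes the edge between `y⁻¹` and `x`. -/
def whiteheadEdges (L : List (α × Bool)) : Set (Sym2 (α × Bool)) :=
  {e | ∃ L', L' ~r L ∧ ∃ y ∈ L'.getLast?, ∃ x ∈ L'.head?, e = s(letterInv y, x)}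

/-- The sign of every letter of `L` is the one that `ε` prescribes for its generator. -/
def HasSigns (ε : α → Bool) (L : List (α × Bool)) : Prop := ∀ x ∈ L, x.2 = ε x.1

theorem cycle_chain_coe_iff {β : Type*} {R : β → β → Prop} {L : List β} :
    Cycle.Chain R (L : Cycle β) ↔ L.IsChain R ∧ ∀ y ∈ L.getLast?, ∀ x ∈ L.head?, R y x := by
  cases L with
  | nil => simp
  | cons a L => rw [Cycle.chain_coe_cons, ← List.cons_append, List.isChain_append]; simp

theorem cycle_chain_of_forall_isRotated {β : Type*} {R : β → β → Prop} {L : List β}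
    (h : ∀ L', L' ~r L → ∀ y ∈ L'.getLast?, ∀ x ∈ L'.head?, R y x) :
    Cycle.Chain R (L : Cycle β) := by
  refine cycle_chain_coe_iff.2
    ⟨List.isChain_iff_forall_rel_of_append_cons_cons.2 ?_, h L (.refl L)⟩
  rintro y x l₁ l₂ rfl
  refine h (x :: l₂ ++ (l₁ ++ [y])) ?_ y ?_ x rfl
  · simpa using List.isRotated_append (l := x :: l₂) (l' := l₁ ++ [y])
  · rw [← List.append_assoc, List.getLast?_concat, Option.mem_some_iff]

theorem isCyclicallyReduced_iff_cycle_chain :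
    IsCyclicallyReduced L ↔ Cycle.Chain (fun y x => y.1 = x.1 → y.2 = x.2) (L : Cycle (α × Bool)) :=
  cycle_chain_coe_iff.symm

theorem isCyclicallyReduced_of_isRotated (hL : IsCyclicallyReduced L) (h : M ~r L) :
    IsCyclicallyReduced M := by
  rw [isCyclicallyReduced_iff_cycle_chain] at hL ⊢
  rwa [Cycle.coe_eq_coe.2 h]

/-- Going around `L`, the relative sign `x.2 ^^ ε x.1` of the letters cannot change from `true` to
`false`. -/
theorem exists_hasSigns (hL : IsCyclicallyReduced L) (ε : α → Bool)
    (h : ∀ i j, i ≠ j → s((i, ε i), (j, ε j)) ∉ whiteheadEdges L) :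
    ∃ b, HasSigns (fun i => ε i ^^ b) L := by
  have chain : Cycle.Chain (· ≤ ·) (Cycle.map (fun x => x.2 ^^ ε x.1) (L : Cycle (α × Bool))) := by
    refine (Cycle.chain_map _).2 (cycle_chain_of_forall_isRotated fun L' hL' y hy x hx => ?_)
    by_contra lt
    obtain ⟨x_eq, y_ne⟩ : x.2 = ε x.1 ∧ y.2 ≠ ε y.1 := by
      simpa [Bool.lt_iff] using lt
    have fst_ne : y.1 ≠ x.1 := fun fst_eq => y_ne <| by
      rw [(isCyclicallyReduced_of_isRotated hL hL').2 y hy x hx fst_eq, fst_eq, x_eq]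
    refine h y.1 x.1 fst_ne ⟨L', hL', y, hy, x, hx, ?_⟩
    rw [letterInv, ← x_eq, Bool.not_eq.2 y_ne]
  cases L with
  | nil => exact ⟨true, by simp [HasSigns]⟩
  | cons x L =>
    refine ⟨x.2 ^^ ε x.1, fun y hy => ?_⟩
    have : (y.2 ^^ ε y.1) = (x.2 ^^ ε x.1) :=
      Cycle.forall_eq_of_chain chain (Cycle.mem_coe_iff.2 (List.mem_map_of_mem hy))
        (Cycle.mem_coe_iff.2 (List.mem_map_of_mem List.mem_cons_self))
    change y.2 = (ε y.1 ^^ (x.2 ^^ ε x.1))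
    rw [← this, Bool.xor_comm y.2, ← Bool.xor_assoc, Bool.xor_self, Bool.false_xor]

theorem exponentSum_mk_of_hasSigns [DecidableEq α] {ε : α → Bool} (hL : HasSigns ε L) (i : α) :
    (exponentSum (mk L)).toAdd i = cond (ε i) 1 (-1) * ((L.map Prod.fst).count i : ℤ) := by
  induction L with
  | nil => simp [← FreeGroup.one_eq_mk]
  | cons x L ih =>
    have head : (exponentSum (mk [x])).toAdd i = if x.1 = i then cond (ε i) 1 (-1) else 0 := by
      have sign_eq : x.2 = ε x.1 := hL x List.mem_cons_self
      by_cases hi : x.1 = i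
      · subst hi
        cases hx : x.2 <;> simp [exponentSum, hx, ← sign_eq]
      · cases hx : x.2 <;> simp [exponentSum, hx, hi, Ne.symm hi]
    rw [← List.singleton_append, ← FreeGroup.mul_mk, map_mul, toAdd_mul, Pi.add_apply, head,
      ih fun y hy => hL y (.tail _ hy), List.singleton_append, List.map_cons, List.count_cons]
    by_cases hi : x.1 = i <;> simp [hi]
    ring

theorem exists_mk_eq_zpow {i : α} (h : ∀ x ∈ L, x.1 = i) : ∃ k : ℤ, mk L = of i ^ k := by
  induction L with
  | nil => exact ⟨0, (zpow_zero _).symm⟩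
  | cons x L ih =>
    obtain ⟨k, hk⟩ := ih fun y hy => h y (.tail _ hy)
    obtain ⟨e, he, -⟩ := exists_mk_singleton_eq_zpow x
    exact ⟨e + k, by rw [zpow_add, ← hk, ← h x List.mem_cons_self, ← he, FreeGroup.mul_mk,
      List.singleton_append]⟩

theorem isUnit_of_eq_zpow_of_isUnit_det [Fintype α] [DecidableEq α] {g : α → FreeGroup α}
    (h : IsUnit (Matrix.of fun i => (exponentSum (g i)).toAdd).det) {i : α} {s : FreeGroup α}
    {k : ℤ} (hi : g i = s ^ k) : IsUnit k := by
  have row_eq : (Matrix.of fun i => (exponentSum (g i)).toAdd) =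
      (Matrix.of fun i => (exponentSum (g i)).toAdd).updateRow i (k • (exponentSum s).toAdd) := by
    rw [← toAdd_zpow, ← map_zpow, ← hi]
    exact (Matrix.updateRow_eq_self _ i).symm
  rw [row_eq, Matrix.det_updateRow_smul] at h
  exact isUnit_of_mul_isUnit_left h

section RankTwo

variable {L M : List (Fin 2 × Bool)} {ε η : Fin 2 → Bool}

theorem exists_hasSigns_or_exists_hasSigns (hL : IsCyclicallyReduced L)
    (hM : IsCyclicallyReduced M) (hLM : Disjoint (whiteheadEdges L) (whiteheadEdges M))
    (ε : Fin 2 → Bool) :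
    (∃ b, HasSigns (fun i => ε i ^^ b) L) ∨ ∃ b, HasSigns (fun i => ε i ^^ b) M := by
  have edge_eq (i j : Fin 2) (hij : i ≠ j) :
      s((i, ε i), (j, ε j)) = s((0, ε 0), (1, ε 1)) := by
    fin_cases i <;> fin_cases j <;> first | contradiction | rfl | exact Sym2.eq_swap
  by_cases hε : s((0, ε 0), (1, ε 1)) ∈ whiteheadEdges L
  · exact .inr (exists_hasSigns hM ε fun i j hij => edge_eq i j hij ▸ hLM.notMem_of_mem_left hε)
  · exact .inl (exists_hasSigns hL ε fun i j hij => edge_eq i j hij ▸ hε)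

theorem exists_forall_fst_eq_of_hasSigns (hε : HasSigns ε L) (hη : HasSigns η L) (h : ε ≠ η) :
    ∃ i, ∀ x ∈ L, x.1 = i := by
  obtain ⟨i, hi⟩ := Function.ne_iff.1 h
  refine ⟨1 - i, fun x hx => ?_⟩
  have : x.1 ≠ i := by
    rintro rfl
    exact hi ((hε x hx).symm.trans (hη x hx))
  omega

theorem count_map_fst_pos (h : ∀ i, ∃ x ∈ L, x.1 ≠ i) (i : Fin 2) :
    0 < (L.map Prod.fst).count i := by
  obtain ⟨x, hx, hxi⟩ := h (1 - i)
  exact List.count_pos_iff.2 (List.mem_map.2 ⟨x, hx, by omega⟩)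

theorem exists_forall_fst_eq_of_isUnit_det (hL : HasSigns ε L) (hM : HasSigns η M)
    (h : (ε 0 == ε 1) ≠ (η 0 == η 1))
    (hdet : IsUnit (Matrix.of fun i => (exponentSum (![mk L, mk M] i)).toAdd).det) :
    (∃ i, ∀ x ∈ L, x.1 = i) ∨ ∃ i, ∀ x ∈ M, x.1 = i := by
  by_contra! hLM
  have pos₁ := mul_pos (Int.natCast_pos.2 (count_map_fst_pos hLM.1 0))
    (Int.natCast_pos.2 (count_map_fst_pos hLM.2 1))
  have pos₂ := mul_pos (Int.natCast_pos.2 (count_map_fst_pos hLM.1 1))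
    (Int.natCast_pos.2 (count_map_fst_pos hLM.2 0))
  simp only [Int.isUnit_iff, Matrix.det_fin_two, Matrix.of_apply, Matrix.cons_val_zero,
    Matrix.cons_val_one, exponentSum_mk_of_hasSigns hL, exponentSum_mk_of_hasSigns hM] at hdet
  cases h₀ : ε 0 <;> cases h₁ : ε 1 <;> cases h₂ : η 0 <;> cases h₃ : η 1 <;>
    simp [h₀, h₁, h₂, h₃] at h hdet <;> omega

theorem exists_mk_eq_mk_singleton (hL : IsCyclicallyReduced L) (hM : IsCyclicallyReduced M)
    (hLM : Disjoint (whiteheadEdges L) (whiteheadEdges M))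
    (hdet : IsUnit (Matrix.of fun i => (exponentSum (![mk L, mk M] i)).toAdd).det) :
    ∃ i x, ![mk L, mk M] i = mk [x] := by
  have exists_forall_fst_eq : (∃ i, ∀ x ∈ L, x.1 = i) ∨ ∃ i, ∀ x ∈ M, x.1 = i := by
    obtain ⟨b, hb⟩ | ⟨b, hb⟩ := exists_hasSigns_or_exists_hasSigns hL hM hLM fun _ => true <;>
      obtain ⟨c, hc⟩ | ⟨c, hc⟩ := exists_hasSigns_or_exists_hasSigns hL hM hLM (· == 0)
    · exact .inl (exists_forall_fst_eq_of_hasSigns hb hc (by clear hb hc; revert b c; decide))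
    · exact exists_forall_fst_eq_of_isUnit_det hb hc (by simp) hdet
    · exact exists_forall_fst_eq_of_isUnit_det hc hb (by simp) hdet
    · exact .inr (exists_forall_fst_eq_of_hasSigns hb hc (by clear hb hc; revert b c; decide))
  obtain ⟨j, i, k, eq⟩ : ∃ j i, ∃ k : ℤ, ![mk L, mk M] j = of i ^ k := by
    obtain ⟨i, hi⟩ | ⟨i, hi⟩ := exists_forall_fst_eq
    · exact ⟨0, i, exists_mk_eq_zpow hi⟩
    · exact ⟨1, i, exists_mk_eq_zpow hi⟩
  obtain rfl | rfl := Int.isUnit_iff.1 (isUnit_of_eq_zpow_of_isUnit_det hdet eq)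
  · exact ⟨j, (i, true), by rw [eq, zpow_one]; rfl⟩
  · exact ⟨j, (i, false), by rw [eq, zpow_neg_one]; rfl⟩

end RankTwo

end WhiteheadGraph

section PingPong

open FreeGroup (lift IsReduced IsCyclicallyReduced)

variable {α : Type*}

theorem exists_letter_ne_ne [Nontrivial α] (u v : α × Bool) : ∃ w, w ≠ u ∧ w ≠ v := by
  obtain ⟨i, hi⟩ := exists_ne u.1
  refine ⟨(i, !v.2), fun h => hi (congrArg Prod.fst h), fun h => ?_⟩
  exact Bool.not_ne_self v.2 (congrArg Prod.snd h)

theorem nontrivial_of_not_commute {s t : FreeGroup α} (h : ¬ Commute s t) : Nontrivial α := by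
  by_contra hα
  rw [not_nontrivial_iff_subsingleton] at hα
  obtain _ | ⟨⟨i⟩⟩ := isEmpty_or_nonempty α
  · exact h (Subsingleton.elim _ _)
  · have := uniqueOfSubsingleton i
    exact h ((Commute.all _ _).of_map FreeGroup.mulEquivIntOfUnique.injective)

theorem closure_conj_pair_eq_top {G : Type*} [Group G] {s t : G}
    (h : Subgroup.closure {s, t} = ⊤) (c : G) :
    Subgroup.closure {c * s * c⁻¹, c * t * c⁻¹} = ⊤ := by
  have := congrArg (Subgroup.map (MulAut.conj c).toMonoidHom) h
  rwa [MonoidHom.map_closure, Set.image_pair,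
    Subgroup.map_top_of_surjective _ (MulAut.conj c).surjective] at this

theorem isConj_mk_of_isRotated {L M : List (α × Bool)} (h : L ~r M) :
    IsConj (FreeGroup.mk L) (FreeGroup.mk M) := by
  obtain ⟨n, rfl⟩ := h
  rw [List.rotate_eq_drop_append_take_mod, ← FreeGroup.mul_mk]
  nth_rw 1 [← List.take_append_drop (n % L.length) L, ← FreeGroup.mul_mk]
  exact isConj_iff.2 ⟨(FreeGroup.mk (L.take (n % L.length)))⁻¹, by group⟩

theorem exists_isCyclicallyReduced_isConj (s : FreeGroup α) :
    ∃ L, IsCyclicallyReduced L ∧ IsConj (FreeGroup.mk L) s := by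
  classical
  refine ⟨FreeGroup.reduceCyclically s.toWord,
    FreeGroup.reduceCyclically.isCyclicallyReduced FreeGroup.isReduced_toWord,
    isConj_iff.2 ⟨FreeGroup.mk (FreeGroup.reduceCyclically.conjugator s.toWord), ?_⟩⟩
  rw [FreeGroup.inv_mk, FreeGroup.mul_mk, FreeGroup.mul_mk,
    FreeGroup.reduceCyclically.conj_conjugator_reduceCyclically, FreeGroup.mk_toWord]

theorem not_isDiag_of_mem_whiteheadEdges {L : List (α × Bool)} (hL : IsCyclicallyReduced L)
    {e : Sym2 (α × Bool)} (he : e ∈ whiteheadEdges L) : ¬ e.IsDiag := by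
  obtain ⟨L', hL', y, hy, x, hx, rfl⟩ := he
  rw [Sym2.mk_isDiag_iff]
  rintro rfl
  exact Bool.not_ne_self y.2 ((isCyclicallyReduced_of_isRotated hL hL').2 y hy _ hx rfl).symm

namespace IsClassicalTSchottkyConfiguration

variable {n : ℕ} {C C' : Fin n → OrientedCircle} {g : Fin n → Moebius}

/-- The circle whose interior is the target of a letter, in the ping-pong game played by the
letters of words. -/
def letterCircle (C C' : Fin n → OrientedCircle) (x : Fin n × Bool) : OrientedCircle :=
  if x.2 then C' x.1 else C x.1

theorem disjoint_letterCircle (H : IsClassicalTSchottkyConfiguration C C' g) {x y : Fin n × Bool}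
    (hxy : x ≠ y) :
    Disjoint (letterCircle C C' x).interior (letterCircle C C' y).interior := by
  obtain ⟨i, _ | _⟩ := x <;> obtain ⟨j, _ | _⟩ := y
  · exact H.disjoint_interiors (i := .inl i) (j := .inl j) (by simpa using hxy)
  · exact H.disjoint_interiors (i := .inl i) (j := .inr j) (by simp)
  · exact H.disjoint_interiors (i := .inr i) (j := .inl j) (by simp)
  · exact H.disjoint_interiors (i := .inr i) (j := .inr j) (by simpa using hxy)

theorem pairsSides_letterCircle (H : IsClassicalTSchottkyConfiguration C C' g)
    (x : Fin n × Bool) :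
    PairsSides (lift g (FreeGroup.mk [x])) (letterCircle C C' (letterInv x))
      (letterCircle C C' x) := by
  have pairs (i : Fin n) : PairsSides (g i) (C i) (C' i) := H.side_pairing i
  obtain ⟨i, _ | _⟩ := x
  · simpa [letterCircle, letterInv] using (pairs i).inv
  · simpa [letterCircle, letterInv] using pairs i

theorem isSchottkyPair_letters (H : IsClassicalTSchottkyConfiguration C C' g)
    {x y : Fin n × Bool} (hxy : x.1 ≠ y.1) :
    IsSchottkyPair (lift g (FreeGroup.mk [x])) (lift g (FreeGroup.mk [y])) := by
  have inv_ne (x : Fin n × Bool) : letterInv x ≠ x := fun h =>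
    Bool.not_ne_self x.2 (congrArg Prod.snd h)
  exact ⟨_, _, letterCircle C C' (letterInv y), _, {
    disjoint_A_A' := H.disjoint_letterCircle (inv_ne x)
    disjoint_A_B := H.disjoint_letterCircle (ne_of_apply_ne Prod.fst hxy)
    disjoint_A_B' := H.disjoint_letterCircle (ne_of_apply_ne Prod.fst hxy)
    disjoint_A'_B := H.disjoint_letterCircle (ne_of_apply_ne Prod.fst hxy)
    disjoint_A'_B' := H.disjoint_letterCircle (ne_of_apply_ne Prod.fst hxy)
    disjoint_B_B' := H.disjoint_letterCircle (inv_ne y)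
    pairsSides_left := H.pairsSides_letterCircle x
    pairsSides_right := H.pairsSides_letterCircle y }⟩

theorem mapsTo_lift_mk (H : IsClassicalTSchottkyConfiguration C C' g) {L : List (Fin n × Bool)}
    (hL : IsReduced L) {x y : Fin n × Bool} (hx : x ∈ L.head?) (hy : y ∈ L.getLast?) :
    Set.MapsTo (lift g (FreeGroup.mk L) • ·) (letterCircle C C' (letterInv y)).exterior
      (letterCircle C C' x).interior := by
  induction L generalizing x with
  | nil => cases hx
  | cons a L ih =>
    obtain rfl := Option.some_inj.1 hx
    obtain _ | ⟨b, L⟩ := L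
    · obtain rfl := Option.some_inj.1 hy
      exact fun z => (H.pairsSides_letterCircle _).smul_mem_interior.2
    · obtain ⟨hab, hL⟩ := List.isChain_cons_cons.1 hL
      have b_ne : b ≠ letterInv a := by
        rintro rfl
        exact Bool.not_ne_self a.2 (hab rfl).symm
      intro z hz
      have tail_mem := ih hL rfl (by simpa using hy) hz
      change lift g (FreeGroup.mk (a :: b :: L)) • z ∈ _
      rw [← List.singleton_append, ← FreeGroup.mul_mk, map_mul, mul_smul,
        (H.pairsSides_letterCircle _).smul_mem_interior]
      exact interior_subset_exterior (H.disjoint_letterCircle b_ne) tail_mem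

theorem lift_injective [Nontrivial (Fin n)] (H : IsClassicalTSchottkyConfiguration C C' g) :
    Function.Injective (lift g) := by
  refine (injective_iff_map_eq_one _).2 fun s hs => ?_
  by_contra s_ne
  have word_ne : s.toWord ≠ [] := mt FreeGroup.toWord_eq_nil_iff.1 s_ne
  obtain ⟨w, w_ne_last, w_ne_head⟩ :=
    exists_letter_ne_ne (letterInv (s.toWord.getLast word_ne)) (s.toWord.head word_ne)
  obtain ⟨z, hz⟩ := (letterCircle C C' w).interior_nonempty
  have smul_mem : lift g (FreeGroup.mk s.toWord) • z ∈ _ :=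
    H.mapsTo_lift_mk FreeGroup.isReduced_toWord (List.head_mem_head? word_ne)
      (List.getLast_mem_getLast? word_ne)
      (interior_subset_exterior (H.disjoint_letterCircle w_ne_last) hz)
  rw [FreeGroup.mk_toWord, hs, one_smul] at smul_mem
  exact Set.disjoint_left.1 (H.disjoint_letterCircle w_ne_head) hz smul_mem

theorem exists_fixedPoint_form_eq_zero (H : IsClassicalTSchottkyConfiguration C C' g)
    {s : FreeGroup (Fin n)} {L : List (Fin n × Bool)} (hL : IsCyclicallyReduced L)
    (conj : IsConj (FreeGroup.mk L) s) (hs : (lift g s).IsParabolic) {e : Sym2 (Fin n × Bool)}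
    (he : e ∈ whiteheadEdges L) : ∃ (c : FreeGroup (Fin n)) (p : OnePoint ℂ),
      lift g (c * s * c⁻¹) • p = p ∧ ∀ w ∈ e, (letterCircle C C' w).form p = 0 := by
  have not_diag := not_isDiag_of_mem_whiteheadEdges hL he
  obtain ⟨L', hL', y, hy, x, hx, rfl⟩ := he
  obtain ⟨c, hc⟩ := isConj_iff.1 ((isConj_mk_of_isRotated hL').trans conj).symm
  have hpar : (lift g (FreeGroup.mk L')).IsParabolic := by
    simpa only [← hc, map_mul, map_inv] using hs.conj (lift g c)
  obtain ⟨p, hp⟩ := hpar.exists_fixedPoint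
  obtain ⟨form_x, form_y⟩ := form_fixedPoint_eq_zero hpar hp
    (H.disjoint_letterCircle (mt Sym2.mk_isDiag_iff.2 not_diag)).symm
    (H.mapsTo_lift_mk (isCyclicallyReduced_of_isRotated hL hL').isReduced hx hy)
  refine ⟨c, p, hc ▸ hp, fun w hw => ?_⟩
  obtain rfl | rfl := Sym2.mem_iff.1 hw
  exacts [form_y, form_x]

theorem disjoint_whiteheadEdges [Nontrivial (Fin n)]
    (H : IsClassicalTSchottkyConfiguration C C' g) {s t : FreeGroup (Fin n)}
    (hgen : Subgroup.closure {s, t} = ⊤) (hs : (lift g s).IsParabolic)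
    (ht : (lift g t).IsParabolic) {L M : List (Fin n × Bool)} (hL : IsCyclicallyReduced L)
    (hM : IsCyclicallyReduced M) (hLs : IsConj (FreeGroup.mk L) s)
    (hMt : IsConj (FreeGroup.mk M) t) :
    Disjoint (whiteheadEdges L) (whiteheadEdges M) := by
  refine Set.disjoint_left.2 fun e heL heM => ?_
  obtain ⟨c, p, hp, form_p⟩ := H.exists_fixedPoint_form_eq_zero hL hLs hs heL
  obtain ⟨d, q, hq, form_q⟩ := H.exists_fixedPoint_form_eq_zero hM hMt ht heM
  have not_diag := not_isDiag_of_mem_whiteheadEdges hL heL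
  induction e with | h u v =>
  obtain ⟨w, hwu, hwv⟩ := exists_letter_ne_ne u v
  obtain rfl : p = q := touching_point_unique
    (H.disjoint_letterCircle (mt Sym2.mk_isDiag_iff.2 not_diag)) (H.disjoint_letterCircle hwu)
    (H.disjoint_letterCircle hwv) (form_p u (Sym2.mem_mk_left u v))
    (form_p v (Sym2.mem_mk_right u v)) (form_q u (Sym2.mem_mk_left u v))
    (form_q v (Sym2.mem_mk_right u v))
  have comm : Commute (lift g (c * s * c⁻¹)) (lift g (d * t * d⁻¹)) := by
    refine Moebius.IsParabolic.commute ?_ ?_ hp hq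
    · simpa only [map_mul, map_inv] using hs.conj (lift g c)
    · simpa only [map_mul, map_inv] using ht.conj (lift g d)
  exact not_commute_conj_of_closure_eq_top hgen c d (comm.of_map H.lift_injective)

theorem isSchottkyPair_of_closure_letter_eq_top [Nontrivial (Fin n)]
    (H : IsClassicalTSchottkyConfiguration C C' g) {x : Fin n × Bool} {w : FreeGroup (Fin n)}
    (hgen : Subgroup.closure {FreeGroup.mk [x], w} = ⊤)
    (hpar : Moebius.IsParabolicPair (lift g (FreeGroup.mk [x])) (lift g w)) :
    IsSchottkyPair (lift g (FreeGroup.mk [x])) (lift g w) := by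
  obtain ⟨m, k, y, hy, rfl⟩ := exists_eq_zpow_mul_mk_mul_zpow hgen
  rw [map_mul, map_mul, map_zpow, map_zpow] at hpar ⊢
  exact (H.isSchottkyPair_letters hy.symm).zpow_mul_mul_zpow m k hpar

theorem isSchottkyPair_of_isConj_letter [Nontrivial (Fin n)]
    (H : IsClassicalTSchottkyConfiguration C C' g) {x : Fin n × Bool} {s t : FreeGroup (Fin n)}
    (hgen : Subgroup.closure {s, t} = ⊤) (hx : IsConj (FreeGroup.mk [x]) s)
    (hpar : Moebius.IsParabolicPair (lift g s) (lift g t)) :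
    IsSchottkyPair (lift g s) (lift g t) := by
  obtain ⟨c, hc⟩ := isConj_iff.1 hx.symm
  have hgen' := closure_conj_pair_eq_top hgen c
  have hpar' := hpar.conj (lift g c)
  simp only [← map_mul, ← map_inv, hc] at hgen' hpar'
  have pair := (H.isSchottkyPair_of_closure_letter_eq_top hgen' hpar').conj (lift g c)⁻¹
  rw [← hc] at pair
  simpa [mul_assoc] using pair

theorem isSchottkyPair_of_closure_eq_top {C C' : Fin 2 → OrientedCircle} {g : Fin 2 → Moebius}
    (H : IsClassicalTSchottkyConfiguration C C' g) {s t : FreeGroup (Fin 2)}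
    (hgen : Subgroup.closure {s, t} = ⊤)
    (hpar : Moebius.IsParabolicPair (lift g s) (lift g t)) :
    IsSchottkyPair (lift g s) (lift g t) := by
  obtain ⟨L, hL, hLs⟩ := exists_isCyclicallyReduced_isConj s
  obtain ⟨M, hM, hMt⟩ := exists_isCyclicallyReduced_isConj t
  have hdet : IsUnit
      (Matrix.of fun i => (exponentSum (![FreeGroup.mk L, FreeGroup.mk M] i)).toAdd).det := by
    obtain ⟨c, rfl⟩ := isConj_iff.1 hLs
    obtain ⟨d, rfl⟩ := isConj_iff.1 hMt
    rw [← Matrix.range_cons_cons_empty _ _ ![]] at hgen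
    have hdet := isUnit_det_exponentSum hgen
    convert hdet using 5 with i
    fin_cases i <;> simp [exponentSum_conj]
  obtain ⟨i, x, hx⟩ := exists_mk_eq_mk_singleton hL hM
    (H.disjoint_whiteheadEdges hgen hpar.left hpar.right hL hM hLs hMt) hdet
  fin_cases i
  · replace hx : FreeGroup.mk L = FreeGroup.mk [x] := hx
    exact H.isSchottkyPair_of_isConj_letter hgen (hx ▸ hLs) hpar
  · replace hx : FreeGroup.mk M = FreeGroup.mk [x] := hx
    rw [Set.pair_comm] at hgen
    exact (H.isSchottkyPair_of_isConj_letter hgen (hx ▸ hMt) hpar.swap).swap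

end IsClassicalTSchottkyConfiguration

end PingPong

theorem theorem6p7 (S T : Moebius) (hS : S.IsParabolic) (hT : T.IsParabolic)
    (hST : ∀ z : OnePoint ℂ, ¬ (S • z = z ∧ T • z = z)) :
    IsMarkedClassicalTSchottky (Subgroup.closure {S, T}) ![S, T] ↔
      IsClassicalTSchottky (Subgroup.closure {S, T}) := by
  refine ⟨fun h => ⟨2, _, h⟩, ?_⟩
  rintro ⟨n, g, hG, C, C', H⟩
  rw [← FreeGroup.range_lift_eq_closure] at hG
  obtain ⟨s, rfl⟩ : S ∈ (FreeGroup.lift g).range := hG ▸ Subgroup.subset_closure (by simp)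
  obtain ⟨t, rfl⟩ : T ∈ (FreeGroup.lift g).range := hG ▸ Subgroup.subset_closure (by simp)
  have hpar : Moebius.IsParabolicPair (FreeGroup.lift g s) (FreeGroup.lift g t) := ⟨hS, hT, hST⟩
  have : Nontrivial (Fin n) := nontrivial_of_not_commute fun h => hpar.not_commute (h.map _)
  have hgen : Subgroup.closure {s, t} = ⊤ := by
    apply Subgroup.map_injective H.lift_injective
    rw [MonoidHom.map_closure, Set.image_pair, hG, MonoidHom.range_eq_map]
  have card_le := card_le_card_of_closure_range_eq_top (g := ![s, t])
    (by rwa [Matrix.range_cons_cons_empty])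
  obtain rfl : n = 2 := le_antisymm (by simpa using card_le) (Fin.nontrivial_iff_two_le.1 this)
  exact isMarkedClassicalTSchottky_closure_pair (H.isSchottkyPair_of_closure_eq_top hgen hpar)
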